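/- Let $b>\pi$ and let $V$ be real-valued and absolutely continuous on $[0,b]$. For $z\in\mathbb C$ let $\xi(\cdot,z)$ be the solution on $[0,b]$ of $$-\xi''(x,z)+V(x)\xi(x,z)=z\,\xi(x,z),\qquad \xi(0,z)=1,\quad \xi'(0,z)=0 .$$ For $0<s\le b$ let $\mathcal B_s$ be the reproducing kernel Hilbert space of all functions $f(z)=\langle\xi(\cdot,\overline z),\varphi\rangle_{L_2(0,s)}$, $\varphi\in L_2(0,s)$, with $\|f\|_{\mathcal B_s}=\|\varphi\|_{L_2(0,s)}$ (inner products are conjugate-linear in the first argument), and let $k_s(z,w)$ be its reproducing kernel. Let $\operatorname{spec}S_\pi(\pi/2)$ be the spectrum of the selfadjoint operator $H_\pi(\pi/2)\varphi=-\varphi''+V\varphi$ in $L_2(0,\pi)$ with boundary conditions $\varphi'(0)=0$, $\varphi'(\pi)=0$; its image $S_\pi(\pi/2)$ under the isometry $\varphi\mapsto f$ is a selfadjoint extension of multiplication by $z$ in $\mathcal B_\pi$ and has the same spectrum. For $g\in\mathcal B_b$ put $$\widehat g(z)=\sum_{t\in\operatorname{spec}S_\pi(\pi/2)} g(t)\,\frac{k_\pi(z,t)}{k_\pi(t,t)},\qquad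 z\in\mathbb C .$$ Then this series converges absolutely for every $g\in\mathcal B_b$ and every $z\in\mathbb C$. Moreover, for every compact $K\subset\mathbb C$ there is a constant $D=D(b,K,V)>0$ such that for all $g\in\mathcal B_b$ and $\psi\in L_2(0,b)$ with $g(z)=\langle\xi(\cdot,\overline z),\psi\rangle_{L_2(0,b)}$ for all $z\in\mathbb C$, $$|g(z)-\widehat g(z)|\le D\int_\pi^b|\psi(x)|\,dx,\qquad z\in K .$$ -/

import Mathlib

open MeasureTheory Set
open scoped ComplexConjugate InnerProductSpace

noncomputable section

namespace UnderSampling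

/-- The complex Hilbert space `L₂(0,s)`; its inner product is conjugate-linear in the first
argument. -/
abbrev L2 (s : ℝ) : Type := Lp ℂ 2 ((volume : Measure ℝ).restrict (Ioo 0 s))

/-- `u, v, η` satisfy, on `[0,s]`: `u` is differentiable with derivative `u' = v`, `v` is absolutely
continuous, and `τ u = -u'' + V u = η` almost everywhere. -/
structure TauEq (V : ℝ → ℝ) (s : ℝ) (u v η : ℝ → ℂ) : Prop where
  hasDeriv : ∀ x ∈ Icc 0 s, HasDerivWithinAt u (v x) (Icc 0 s) x
  absCont : AbsolutelyContinuousOnInterval v 0 s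
  eqn : ∀ᵐ x, x ∈ Ioo 0 s → ∃ v' : ℂ, HasDerivAt v v' x ∧ -v' + (V x : ℂ) * u x = η x

/-- `u` solves `τ u = z u` on `[0,s]` with `u(0) = 1`, `u'(0) = 0`. -/
def IsXi (V : ℝ → ℝ) (s : ℝ) (z : ℂ) (u : ℝ → ℂ) : Prop :=
  ∃ v : ℝ → ℂ, TauEq V s u v (fun x => z * u x) ∧ u 0 = 1 ∧ v 0 = 0

open Classical in
/-- `x ↦ ξ(x,z)` on `[0,s]`: the solution of the initial value problem `τ ξ = z ξ`, `ξ(0,z) = 1`,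
`ξ'(0,z) = 0`. For `V` integrable on `(0,s)` there is exactly one on `[0,s]`, and the solution
on a longer interval restricts to the one on a shorter interval. -/
def xi (V : ℝ → ℝ) (s : ℝ) (z : ℂ) : ℝ → ℂ :=
  if h : ∃ u, IsXi V s z u then h.choose else 0

theorem memLp_xi (V : ℝ → ℝ) (s : ℝ) (z : ℂ) :
    MemLp (xi V s z) 2 ((volume : Measure ℝ).restrict (Ioo 0 s)) := by
  unfold xi
  split_ifs with h
  · obtain ⟨v, hv, -, -⟩ := h.choose_spec
    have hc : ContinuousOn h.choose (Icc 0 s) := fun x hx => (hv.hasDeriv x hx).continuousWithinAt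
    obtain ⟨C, hC⟩ := isCompact_Icc.exists_bound_of_continuousOn hc
    refine MemLp.of_bound
      ((hc.mono Ioo_subset_Icc_self).aestronglyMeasurable measurableSet_Ioo) C ?_
    filter_upwards [ae_restrict_mem measurableSet_Ioo] with x hx
    exact hC x (Ioo_subset_Icc_self hx)
  · exact MemLp.zero

/-- `ξ(·,z)` as an element of `L₂(0,s)`. -/
def xiL2 (V : ℝ → ℝ) (s : ℝ) (z : ℂ) : L2 s := (memLp_xi V s z).toLp _

/-- The map `φ ↦ f`, `f(z) = ⟨ξ(·,z̄), φ⟩`, from `L₂(0,s)` to functions on `ℂ`. -/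
def transform (V : ℝ → ℝ) (s : ℝ) : L2 s →L[ℂ] (ℂ → ℂ) :=
  ContinuousLinearMap.pi fun z => innerSL ℂ (xiL2 V s (conj z))

theorem transform_apply (V : ℝ → ℝ) (s : ℝ) (φ : L2 s) (z : ℂ) :
    transform V s φ z = ⟪xiL2 V s (conj z), φ⟫_ℂ := rfl

theorem isClosed_ker_transform (V : ℝ → ℝ) (s : ℝ) :
    IsClosed ((transform V s).ker : Set (L2 s)) :=
  (transform V s).isClosed_ker

/-- The de Branges space `B_s` of all functions `f(z) = ⟨ξ(·,z̄), φ⟩`, `φ ∈ L₂(0,s)`, with the norm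
that makes `φ ↦ f` an isometry. An element is recorded by the `φ` orthogonal to the kernel of
`φ ↦ f` that represents it (the kernel is in fact trivial), so that the norm is the one of `L₂(0,s)`
and every transform occurs exactly once. -/
def DeBranges (V : ℝ → ℝ) (s : ℝ) : Submodule ℂ (L2 s) := (transform V s).kerᗮ

instance (V : ℝ → ℝ) (s : ℝ) : CompleteSpace (DeBranges V s) :=
  (Submodule.isClosed_orthogonal _).completeSpace_coe

/-- `B_s` as a reproducing kernel Hilbert space of functions on `ℂ`: the function that belongs to
`φ` is `z ↦ ⟨ξ(·,z̄), φ⟩`. -/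
instance (V : ℝ → ℝ) (s : ℝ) : RKHS ℂ (DeBranges V s) ℂ ℂ where
  coeCLM := (transform V s).comp (DeBranges V s).subtypeL
  coeCLM_injective := by
    refine (injective_iff_map_eq_zero
      ((transform V s).comp (DeBranges V s).subtypeL)).mpr fun φ hφ => ?_
    have h1 : (φ : L2 s) ∈ (transform V s).ker := hφ
    have h2 : ⟪(φ : L2 s), (φ : L2 s)⟫_ℂ = 0 := φ.2 _ h1
    exact Subtype.ext (inner_self_eq_zero.mp h2)

theorem deBranges_apply (V : ℝ → ℝ) (s : ℝ) (f : DeBranges V s) (z : ℂ) :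
    f z = ⟪xiL2 V s (conj z), (f : L2 s)⟫_ℂ := rfl

/-- The functions in `B_s` are all the transforms of elements of `L₂(0,s)`. -/
theorem exists_deBranges_eq (V : ℝ → ℝ) (s : ℝ) (φ : L2 s) :
    ∃ f : DeBranges V s, ∀ z, f z = transform V s φ z := by
  have : CompleteSpace (transform V s).ker :=
    (isClosed_ker_transform V s).completeSpace_coe
  obtain ⟨y, hy, w, hw, rfl⟩ := (transform V s).ker.exists_add_mem_mem_orthogonal φ
  refine ⟨⟨w, hw⟩, fun z => ?_⟩
  have hy0 : transform V s y = 0 := hy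
  rw [map_add, hy0, zero_add]
  rfl

/-- The reproducing kernel `k_s(z,w)` of `B_s`. -/
def kernel (V : ℝ → ℝ) (s : ℝ) (z w : ℂ) : ℂ := RKHS.kernel (DeBranges V s) z w 1

theorem kernel_eq_inner (V : ℝ → ℝ) (s : ℝ) (z w : ℂ) :
    kernel V s z w = ⟪xiL2 V s (conj z), xiL2 V s (conj w)⟫_ℂ := by
  have hmem : xiL2 V s (conj w) ∈ DeBranges V s := by
    rw [DeBranges, Submodule.mem_orthogonal']
    intro u hu
    exact congrFun (show transform V s u = 0 from hu) w
  have hk : RKHS.kerFun (DeBranges V s) w (1 : ℂ) = ⟨xiL2 V s (conj w), hmem⟩ := by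
    refine ext_inner_right ℂ fun f => ?_
    rw [RKHS.kerFun_inner, deBranges_apply]
    simp [Submodule.coe_inner]
  rw [kernel, ← RKHS.kerFun_apply, hk, deBranges_apply]

/-- The graph of the operator `H_s(γ)`. -/
def hGraph (V : ℝ → ℝ) (s γ : ℝ) : Submodule ℂ (L2 s × L2 s) where
  carrier := {p | ∃ u v : ℝ → ℂ, TauEq V s u v p.2 ∧
    (∀ᵐ x, x ∈ Ioo 0 s → p.1 x = u x) ∧
    v 0 = 0 ∧ u s * (Real.cos γ : ℂ) + v s * (Real.sin γ : ℂ) = 0}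
  add_mem' := by
    rintro p q ⟨u, v, h, hu, h0, hs⟩ ⟨u', v', h', hu', h0', hs'⟩
    refine ⟨u + u', v + v', ⟨fun x hx => (h.hasDeriv x hx).add (h'.hasDeriv x hx),
      h.absCont.add h'.absCont, ?_⟩, ?_, by simp [h0, h0'], ?_⟩
    · have e := (ae_restrict_iff' measurableSet_Ioo).mp (Lp.coeFn_add p.2 q.2)
      filter_upwards [h.eqn, h'.eqn, e] with x h1 h2 h3 hx
      obtain ⟨a, ha, hae⟩ := h1 hx
      obtain ⟨c, hc, hce⟩ := h2 hx
      refine ⟨a + c, ha.add hc, ?_⟩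
      rw [Prod.snd_add, h3 hx, Pi.add_apply, Pi.add_apply, ← hae, ← hce]
      ring
    · have e := (ae_restrict_iff' measurableSet_Ioo).mp (Lp.coeFn_add p.1 q.1)
      filter_upwards [hu, hu', e] with x h1 h2 h3 hx
      rw [Prod.fst_add, h3 hx, Pi.add_apply, Pi.add_apply, h1 hx, h2 hx]
    · simp only [Pi.add_apply]
      linear_combination hs + hs'
  zero_mem' := by
    refine ⟨0, 0, ⟨fun x _ => hasDerivWithinAt_const _ _ _, ?_, ?_⟩, ?_, rfl, by simp⟩
    · simpa [AbsolutelyContinuousOnInterval] using tendsto_const_nhds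
    · have e := (ae_restrict_iff' measurableSet_Ioo).mp
        (Lp.coeFn_zero ℂ 2 ((volume : Measure ℝ).restrict (Ioo 0 s)))
      filter_upwards [e] with x h3 hx
      refine ⟨0, hasDerivAt_const _ _, ?_⟩
      rw [Prod.snd_zero, h3 hx]
      simp
    · exact (ae_restrict_iff' measurableSet_Ioo).mp
        (Lp.coeFn_zero ℂ 2 ((volume : Measure ℝ).restrict (Ioo 0 s)))
  smul_mem' := by
    rintro c p ⟨u, v, h, hu, h0, hs⟩
    refine ⟨c • u, c • v, ⟨fun x hx => (h.hasDeriv x hx).const_smul c, ?_, ?_⟩, ?_,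
      by simp [h0], ?_⟩
    · have := h.absCont
      unfold AbsolutelyContinuousOnInterval at this ⊢
      simpa only [Pi.smul_apply, dist_smul₀, Finset.mul_sum, mul_zero] using this.const_mul ‖c‖
    · have e := (ae_restrict_iff' measurableSet_Ioo).mp (Lp.coeFn_smul c p.2)
      filter_upwards [h.eqn, e] with x h1 h3 hx
      obtain ⟨a, ha, hae⟩ := h1 hx
      refine ⟨c • a, ha.const_smul c, ?_⟩
      rw [Prod.smul_snd, h3 hx, Pi.smul_apply, Pi.smul_apply, ← hae]
      simp only [smul_eq_mul]
      ring
    · have e := (ae_restrict_iff' measurableSet_Ioo).mp (Lp.coeFn_smul c p.1)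
      filter_upwards [hu, e] with x h1 h3 hx
      rw [Prod.smul_fst, h3 hx, Pi.smul_apply, Pi.smul_apply, h1 hx]
    · simp only [Pi.smul_apply, smul_eq_mul]
      linear_combination c * hs

/-- `τ φ` is determined by `φ`, so that `hGraph` is the graph of an operator. -/
theorem hGraph_snd_eq_zero (V : ℝ → ℝ) (s γ : ℝ) (p : L2 s × L2 s) (hp : p ∈ hGraph V s γ)
    (h0 : p.1 = 0) : p.2 = 0 := by
  obtain ⟨u, v, h, hu, -, -⟩ := hp
  have hz := (ae_restrict_iff' measurableSet_Ioo).mp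
    (Lp.coeFn_zero ℂ 2 ((volume : Measure ℝ).restrict (Ioo 0 s)))
  have hc : ContinuousOn u (Ioo 0 s) := fun x hx =>
    ((h.hasDeriv x (Ioo_subset_Icc_self hx)).continuousWithinAt).mono Ioo_subset_Icc_self
  have hu0 : EqOn u 0 (Ioo 0 s) := by
    refine Measure.eqOn_open_of_ae_eq (μ := (volume : Measure ℝ)) ?_ isOpen_Ioo hc
      continuousOn_const
    refine (ae_restrict_iff' measurableSet_Ioo).mpr ?_
    filter_upwards [hu, hz] with x h1 h2 hx
    rw [← h1 hx, h0, h2 hx]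
  have hv0 : EqOn v 0 (Ioo 0 s) := by
    intro x hx
    have hn : Ioo 0 s ∈ nhds x := isOpen_Ioo.mem_nhds hx
    have h1 : HasDerivAt u (v x) x :=
      (h.hasDeriv x (Ioo_subset_Icc_self hx)).hasDerivAt
        (Filter.mem_of_superset hn Ioo_subset_Icc_self)
    have h2 : HasDerivAt u 0 x := (hasDerivAt_const x (0 : ℂ)).congr_of_eventuallyEq
      (Filter.mem_of_superset hn hu0)
    exact h1.unique h2
  refine Lp.ext ((ae_restrict_iff' measurableSet_Ioo).mpr ?_)
  filter_upwards [h.eqn, hz] with x h1 h2 hx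
  obtain ⟨a, ha, hae⟩ := h1 hx
  have hn : Ioo 0 s ∈ nhds x := isOpen_Ioo.mem_nhds hx
  have h3 : HasDerivAt v 0 x := (hasDerivAt_const x (0 : ℂ)).congr_of_eventuallyEq
    (Filter.mem_of_superset hn hv0)
  have hu0x : u x = 0 := hu0 hx
  rw [← hae, ha.unique h3, hu0x, h2 hx]
  simp

/-- The operator `H_s(γ)` in `L₂(0,s)`: `H_s(γ) φ = τ φ`, on the domain of all `φ ∈ L₂(0,s)` with
`τ φ ∈ L₂(0,s)`, `φ'(0) = 0` and `φ(s) cos γ + φ'(s) sin γ = 0`. -/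
def hOp (V : ℝ → ℝ) (s γ : ℝ) : L2 s →ₗ.[ℂ] L2 s := (hGraph V s γ).toLinearPMap

theorem hOp_graph (V : ℝ → ℝ) (s γ : ℝ) : (hOp V s γ).graph = hGraph V s γ :=
  Submodule.toLinearPMap_graph_eq _ (fun p hp h0 => hGraph_snd_eq_zero V s γ p hp h0)

/-- The spectrum of an unbounded operator `T`: the complement of the set of all `z` for which
`T - z` is a bijection of the domain of `T` onto the space with bounded inverse. -/
def spec {E : Type*} [NormedAddCommGroup E] [NormedSpace ℂ E] (T : E →ₗ.[ℂ] E) : Set ℂ :=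
  {z | ∃ R : E →L[ℂ] E, (∀ y, ∃ h : R y ∈ T.domain, T ⟨R y, h⟩ - z • R y = y) ∧
    ∀ x : T.domain, R (T x - z • (x : E)) = x}ᶜ

/-- The term `g(t) k_a(z,t) / k_a(t,t)` of the sampling series. -/
def sampleTerm (V : ℝ → ℝ) (a : ℝ) (g : ℂ → ℂ) (z t : ℂ) : ℂ :=
  g t * (kernel V a z t / kernel V a t t)

/-- The sampling series `ĝ(z) = ∑ g(t) k_a(z,t) / k_a(t,t)` over the spectrum of `H_a(γ)`, which is
the spectrum of the unitarily equivalent operator `S_a(γ)` in `B_a`. -/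
def sampleSeries (V : ℝ → ℝ) (a γ : ℝ) (g : ℂ → ℂ) (z : ℂ) : ℂ :=
  ∑' t : spec (hOp V a γ), sampleTerm V a g z t

end UnderSampling

end

/-! ### Absolutely continuous complex-valued functions. -/

namespace UnderSampling

/-! Split `ψ` into its restriction to `(0,π)` and its tail on `(π,b)`. On the transform of the
restriction the sampling series is exact: for `t` in the Neumann spectrum the `ξ(·,t)` are the
eigenfunctions, orthogonal and complete in `L₂(0,π)`, with `k(t,t) = ‖ξ(·,t)‖²`, so the series is
Parseval's identity (`hasSum_sampleTerm`). Hence `g - ĝ` is the tail transform minus its own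
sampling series, and each is to be bounded by a multiple of `∫_π^b |ψ|`.

The tail transform is at most `sup |ξ|` times this integral, locally uniformly in `z`; on the
spectrum, which is real and bounded below, the supremum is uniform (`exists_bound_xi_real`). It
remains to sum `k(z,t) / k(t,t)`. Choose `c` with `V + c ≥ 1`. Green's identity turns `(t - z)
k(z,t)` into a bounded boundary term, so `|k(z,t)| ≤ A / (t + c)` (`exists_kernel_bound`).

The sum of `a_t = 1 / ((t + c) ‖ξ(·,t)‖²)` is bounded without eigenvalue asymptotics. For a finite
set of eigenvalues put `f = ∑ a_t ξ(·,t)`; both `f(0)` and the form of `H + c` at `f` equal `S = ∑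
a_t`, and the trace inequality `|f(0)|² ≤ (1 + 1/s) · form` reads `S² ≤ (1 + 1/s) S` (`sum_inv_le`).

Existence of `ξ` and of the resolvent comes from the Fredholm alternative for a compact Volterra
operator, with Gronwall excluding a kernel (`isUnit_one_sub_volterra`). Completeness is the spectral
theorem for the compact symmetric resolvent (`eq_zero_of_inner_xiL2`). -/

theorem absCont_lipschitz_comp {X Y : Type*} [PseudoMetricSpace X]
    [PseudoMetricSpace Y] {f : ℝ → X} {a b : ℝ} {K : NNReal} {φ : X → Y} (hφ : LipschitzWith K φ)
    (hf : AbsolutelyContinuousOnInterval f a b) :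
    AbsolutelyContinuousOnInterval (fun x => φ (f x)) a b := by
  unfold AbsolutelyContinuousOnInterval at hf ⊢
  refine squeeze_zero (fun E => Finset.sum_nonneg fun i _ => dist_nonneg) (fun E => ?_)
    (by simpa using hf.const_mul (K : ℝ))
  rw [Finset.mul_sum]
  exact Finset.sum_le_sum fun i _ => hφ.dist_le_mul _ _

theorem lipschitz_re : LipschitzWith 1 Complex.re :=
  LipschitzWith.of_dist_le_mul fun x y => by
    simpa [dist_eq_norm, ← Complex.sub_re] using Complex.abs_re_le_norm (x - y)

theorem lipschitz_im : LipschitzWith 1 Complex.im :=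
  LipschitzWith.of_dist_le_mul fun x y => by
    simpa [dist_eq_norm, ← Complex.sub_im] using Complex.abs_im_le_norm (x - y)

theorem integral_re_eq {w : ℝ → ℂ} {a b : ℝ} (hw : IntervalIntegrable w volume a b) :
    ∫ x in a..b, (w x).re = (∫ x in a..b, w x).re :=
  Complex.reCLM.intervalIntegral_comp_comm hw

theorem integral_im_eq {w : ℝ → ℂ} {a b : ℝ} (hw : IntervalIntegrable w volume a b) :
    ∫ x in a..b, (w x).im = (∫ x in a..b, w x).im :=
  Complex.imCLM.intervalIntegral_comp_comm hw

theorem intervalIntegrable_re {w : ℝ → ℂ} {a b : ℝ} (hw : IntervalIntegrable w volume a b) :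
    IntervalIntegrable (fun x => (w x).re) volume a b :=
  ⟨hw.1.re, hw.2.re⟩

theorem intervalIntegrable_im {w : ℝ → ℂ} {a b : ℝ} (hw : IntervalIntegrable w volume a b) :
    IntervalIntegrable (fun x => (w x).im) volume a b :=
  ⟨hw.1.im, hw.2.im⟩

/-- Fundamental theorem of calculus for complex-valued absolutely continuous functions. -/
theorem integral_eq_sub_of_absCont {v w : ℝ → ℂ} {a b : ℝ} (hab : a ≤ b)
    (hv : AbsolutelyContinuousOnInterval v a b)
    (hw : IntervalIntegrable w volume a b)
    (h : ∀ᵐ x, x ∈ Ioo a b → HasDerivAt v (w x) x) :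
    ∫ x in a..b, w x = v b - v a := by
  have hne : ∀ᵐ x : ℝ, x ≠ b := by simp [ae_iff, measure_singleton]
  refine Complex.ext ?_ ?_
  · rw [← integral_re_eq hw, Complex.sub_re,
      ← (absCont_lipschitz_comp lipschitz_re hv).integral_deriv_eq_sub]
    refine intervalIntegral.integral_congr_ae ?_
    filter_upwards [h, hne] with x hx hxb hxm
    rw [uIoc_of_le hab] at hxm
    exact ((Complex.reCLM.hasFDerivAt.comp_hasDerivAt x
      (hx ⟨hxm.1, lt_of_le_of_ne hxm.2 hxb⟩)).deriv).symm
  · rw [← integral_im_eq hw, Complex.sub_im,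
      ← (absCont_lipschitz_comp lipschitz_im hv).integral_deriv_eq_sub]
    refine intervalIntegral.integral_congr_ae ?_
    filter_upwards [h, hne] with x hx hxb hxm
    rw [uIoc_of_le hab] at hxm
    exact ((Complex.imCLM.hasFDerivAt.comp_hasDerivAt x
      (hx ⟨hxm.1, lt_of_le_of_ne hxm.2 hxb⟩)).deriv).symm

theorem absCont_integral {w : ℝ → ℂ} {a b : ℝ} (hw : IntervalIntegrable w volume a b) :
    AbsolutelyContinuousOnInterval (fun x => ∫ y in a..x, w y) a b := by
  have h1 := (intervalIntegrable_re hw).absolutelyContinuousOnInterval_intervalIntegral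
    (c := a) left_mem_uIcc
  have h2 := (intervalIntegrable_im hw).absolutelyContinuousOnInterval_intervalIntegral
    (c := a) left_mem_uIcc
  have h3 := (absCont_lipschitz_comp
    Complex.isometry_ofReal.lipschitz h1).add
    ((absCont_lipschitz_comp
      Complex.isometry_ofReal.lipschitz h2).const_smul Complex.I)
  -- The recombined real and imaginary parts are known to agree with the integral only on `uIcc a
  -- b`, so the two functions are exchanged in the ε-δ form, where all points lie there.
  rw [absolutelyContinuousOnInterval_iff] at h3 ⊢
  intro ε hε
  obtain ⟨δ, hδ, H⟩ := h3 ε hε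
  refine ⟨δ, hδ, fun E hE hE' => ?_⟩
  convert H E hE hE' using 1
  refine Finset.sum_congr rfl fun i hi => ?_
  have key : ∀ x ∈ uIcc a b, ∫ y in a..x, w y =
      ((fun x => ((∫ y in a..x, (w y).re : ℝ) : ℂ)) +
        Complex.I • fun x => ((∫ y in a..x, (w y).im : ℝ) : ℂ)) x := by
    intro x hx
    have hx' : IntervalIntegrable w volume a x :=
      hw.mono_set (uIcc_subset_uIcc left_mem_uIcc hx)
    simp only [Pi.add_apply, Pi.smul_apply, integral_re_eq hx', integral_im_eq hx', smul_eq_mul]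
    rw [mul_comm, Complex.re_add_im]
  rw [key _ (hE.1 i hi).1, key _ (hE.1 i hi).2]
  rfl

/-- The derivative is bounded on the compact interval, so `u` is Lipschitz. -/
theorem absCont_of_hasDeriv {u v : ℝ → ℂ} {s : ℝ} (hs : 0 ≤ s)
    (hu : ∀ x ∈ Icc 0 s, HasDerivWithinAt u (v x) (Icc 0 s) x) (hv : ContinuousOn v (Icc 0 s)) :
    AbsolutelyContinuousOnInterval u 0 s := by
  obtain ⟨C, hC⟩ := isCompact_Icc.exists_bound_of_continuousOn hv
  have : LipschitzOnWith C.toNNReal u (uIcc 0 s) := by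
    rw [uIcc_of_le hs]
    refine (convex_Icc 0 s).lipschitzOnWith_of_nnnorm_hasDerivWithin_le hu fun x hx => ?_
    rw [← NNReal.coe_le_coe, coe_nnnorm]
    exact (hC x hx).trans (Real.le_coe_toNNReal C)
  exact this.absolutelyContinuousOnInterval

/-! ### The equation `τ u = η`: linearity, Green's identity, Gronwall. -/

variable {V : ℝ → ℝ} {s : ℝ} {u v η u₁ v₁ η₁ u₂ v₂ η₂ : ℝ → ℂ} {z : ℂ}

theorem TauEq.continuousOn (h : TauEq V s u v η) : ContinuousOn u (Icc 0 s) :=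
  fun x hx => (h.hasDeriv x hx).continuousWithinAt

theorem TauEq.continuousOn_deriv (hs : 0 ≤ s) (h : TauEq V s u v η) :
    ContinuousOn v (Icc 0 s) := by
  simpa [uIcc_of_le hs] using h.absCont.continuousOn

theorem TauEq.mono {s' : ℝ} (hs' : 0 ≤ s') (hss : s' ≤ s) (h : TauEq V s u v η) :
    TauEq V s' u v η where
  hasDeriv x hx := (h.hasDeriv x ⟨hx.1, hx.2.trans hss⟩).mono (Icc_subset_Icc_right hss)
  absCont := h.absCont.mono (by
    rw [uIcc_of_le hs', uIcc_of_le (hs'.trans hss)]; exact Icc_subset_Icc_right hss)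
  eqn := by
    filter_upwards [h.eqn] with x hx hx'
    exact hx ⟨hx'.1, hx'.2.trans_le hss⟩

theorem TauEq.congr (h : TauEq V s u v η) (he : ∀ᵐ x, x ∈ Ioo 0 s → η x = η₁ x) :
    TauEq V s u v η₁ where
  hasDeriv := h.hasDeriv
  absCont := h.absCont
  eqn := by
    filter_upwards [h.eqn, he] with x h1 h2 hx
    rw [← h2 hx]
    exact h1 hx

theorem TauEq.conj (h : TauEq V s u v η) :
    TauEq V s (fun x => conj (u x)) (fun x => conj (v x)) (fun x => conj (η x)) where
  hasDeriv x hx := (h.hasDeriv x hx).star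
  absCont := absCont_lipschitz_comp Complex.isometry_conj.lipschitz h.absCont
  eqn := by
    filter_upwards [h.eqn] with x h1 hx
    obtain ⟨a, ha, hae⟩ := h1 hx
    refine ⟨conj a, ha.star, ?_⟩
    rw [← hae]
    simp

theorem TauEq.add (h₁ : TauEq V s u₁ v₁ η₁) (h₂ : TauEq V s u₂ v₂ η₂) :
    TauEq V s (fun x => u₁ x + u₂ x) (fun x => v₁ x + v₂ x) (fun x => η₁ x + η₂ x) where
  hasDeriv x hx := (h₁.hasDeriv x hx).add (h₂.hasDeriv x hx)
  absCont := h₁.absCont.add h₂.absCont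
  eqn := by
    filter_upwards [h₁.eqn, h₂.eqn] with x e₁ e₂ hx
    obtain ⟨a, ha, hae⟩ := e₁ hx
    obtain ⟨c, hc, hce⟩ := e₂ hx
    refine ⟨a + c, ha.add hc, ?_⟩
    rw [← hae, ← hce]
    ring

theorem TauEq.const_mul (c : ℂ) (h : TauEq V s u v η) :
    TauEq V s (fun x => c * u x) (fun x => c * v x) (fun x => c * η x) where
  hasDeriv x hx := (h.hasDeriv x hx).const_mul c
  absCont := h.absCont.const_smul c
  eqn := by
    filter_upwards [h.eqn] with x e₁ hx
    obtain ⟨a, ha, hae⟩ := e₁ hx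
    refine ⟨c * a, ha.const_mul c, ?_⟩
    rw [← hae]
    ring

theorem intervalIntegrable_of_continuousOn (hs : 0 ≤ s) (h : ContinuousOn u (Icc 0 s)) :
    IntervalIntegrable u volume 0 s :=
  ContinuousOn.intervalIntegrable (by rwa [uIcc_of_le hs])

theorem continuousOn_potential (hV : ContinuousOn V (Icc 0 s)) :
    ContinuousOn (fun x => (V x : ℂ)) (Icc 0 s) :=
  Complex.continuous_ofReal.comp_continuousOn hV

/-- Integration by parts: the sesquilinear form of `τ`. -/
theorem TauEq.integral_form (hs : 0 ≤ s) (hV : ContinuousOn V (Icc 0 s))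
    (h₁ : TauEq V s u₁ v₁ η₁) (h₂ : TauEq V s u₂ v₂ η₂) (hη : IntervalIntegrable η₁ volume 0 s) :
    ∫ x in 0..s, (v₁ x * v₂ x + V x * u₁ x * u₂ x) =
      (∫ x in 0..s, η₁ x * u₂ x) + (v₁ s * u₂ s - v₁ 0 * u₂ 0) := by
  have hc₁ := h₁.continuousOn
  have hc₂ := h₂.continuousOn
  have hd₁ := h₁.continuousOn_deriv hs
  have hd₂ := h₂.continuousOn_deriv hs
  have hVc := continuousOn_potential hV
  have i1 : IntervalIntegrable (fun x => v₁ x * v₂ x + V x * u₁ x * u₂ x) volume 0 s :=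
    intervalIntegrable_of_continuousOn hs ((hd₁.mul hd₂).add ((hVc.mul hc₁).mul hc₂))
  have i2 : IntervalIntegrable (fun x => η₁ x * u₂ x) volume 0 s :=
    hη.mul_continuousOn (by rwa [uIcc_of_le hs])
  -- The fundamental theorem for the product `v₁ u₂`, whose derivative is almost everywhere `v₁ v₂ +
  -- V u₁ u₂ - η₁ u₂`.
  have key := integral_eq_sub_of_absCont hs
    (h₁.absCont.smul (absCont_of_hasDeriv hs h₂.hasDeriv hd₂)) (i1.sub i2) (by
      filter_upwards [h₁.eqn] with x e₁ hx
      obtain ⟨a, ha, hae⟩ := e₁ hx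
      have hu : HasDerivAt u₂ (v₂ x) x :=
        (h₂.hasDeriv x (Ioo_subset_Icc_self hx)).hasDerivAt (Icc_mem_nhds hx.1 hx.2)
      refine (ha.mul hu).congr_deriv ?_
      rw [← hae]
      ring)
  rw [intervalIntegral.integral_sub i1 i2] at key
  simp only [Pi.smul_apply', smul_eq_mul] at key
  linear_combination key

/-- Green's identity. -/
theorem TauEq.green (hs : 0 ≤ s) (hV : ContinuousOn V (Icc 0 s))
    (h₁ : TauEq V s u₁ v₁ η₁) (h₂ : TauEq V s u₂ v₂ η₂) (hη₁ : IntervalIntegrable η₁ volume 0 s)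
    (hη₂ : IntervalIntegrable η₂ volume 0 s) :
    (∫ x in 0..s, η₁ x * u₂ x) + (v₁ s * u₂ s - v₁ 0 * u₂ 0) =
      (∫ x in 0..s, u₁ x * η₂ x) + (u₁ s * v₂ s - u₁ 0 * v₂ 0) := by
  have e1 := h₁.integral_form hs hV h₂ hη₁
  have e2 := h₂.integral_form hs hV h₁ hη₂
  have e3 : ∫ x in 0..s, (v₁ x * v₂ x + V x * u₁ x * u₂ x) =
      ∫ x in 0..s, (v₂ x * v₁ x + V x * u₂ x * u₁ x) := by
    congr 1; ext x; ring
  have e4 : ∫ x in 0..s, u₁ x * η₂ x = ∫ x in 0..s, η₂ x * u₁ x := by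
    congr 1; ext x; ring
  rw [← e1, e3, e2, e4]
  ring

/-- The almost everywhere derivative of `v` is the continuous function `(V - z) u`, so `v` is its
indefinite integral and is differentiable at every point. Gronwall's inequality needs this. -/
theorem TauEq.hasDeriv_deriv (hs : 0 ≤ s) (hV : ContinuousOn V (Icc 0 s))
    (h : TauEq V s u v (fun x => z * u x)) :
    ∀ x ∈ Icc 0 s, HasDerivWithinAt v ((V x - z) * u x) (Icc 0 s) x := by
  have hc : ContinuousOn (fun x => ((V x : ℂ) - z) * u x) (Icc 0 s) :=
    ((continuousOn_potential hV).sub continuousOn_const).mul h.continuousOn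
  have hi := intervalIntegrable_of_continuousOn hs hc
  have key : ∀ x ∈ Icc 0 s, v x = v 0 + ∫ y in 0..x, ((V y : ℂ) - z) * u y := by
    intro x hx
    have hsub : uIcc 0 x ⊆ uIcc 0 s := by
      rw [uIcc_of_le hx.1, uIcc_of_le hs]; exact Icc_subset_Icc_right hx.2
    rw [integral_eq_sub_of_absCont hx.1 (h.absCont.mono hsub) (hi.mono_set hsub)]
    · ring
    · filter_upwards [h.eqn] with y e hy
      obtain ⟨a, ha, hae⟩ := e ⟨hy.1, hy.2.trans_le hx.2⟩
      refine ha.congr_deriv ?_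
      linear_combination -hae
  intro x hx
  have hF : HasDerivWithinAt (fun x => v 0 + ∫ y in 0..x, ((V y : ℂ) - z) * u y)
      (((V x : ℂ) - z) * u x) (Icc 0 s) x := by
    have : Fact (x ∈ Icc 0 s) := ⟨hx⟩
    refine (intervalIntegral.integral_hasDerivWithinAt_right ?_ ?_ (hc x hx)).const_add _
    · exact hi.mono_set (by rw [uIcc_of_le hx.1, uIcc_of_le hs]; exact Icc_subset_Icc_right hx.2)
    · exact hc.stronglyMeasurableAtFilter_nhdsWithin measurableSet_Icc x
  exact hF.congr key (key x hx)

/-- Gronwall for the system `(u, v)' = (v, (V - z) u)` in the maximum norm; `1 ≤ L` takes care of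
the first component. Zero initial data give uniqueness. -/
theorem TauEq.norm_le (hs : 0 ≤ s) (hV : ContinuousOn V (Icc 0 s))
    (h : TauEq V s u v (fun x => z * u x)) {L : ℝ} (hL : 1 ≤ L)
    (hVL : ∀ x ∈ Icc 0 s, ‖(V x : ℂ) - z‖ ≤ L) :
    ∀ x ∈ Icc 0 s, ‖(u x, v x)‖ ≤ ‖(u 0, v 0)‖ * Real.exp (L * x) := by
  have hd := h.hasDeriv_deriv hs hV
  intro x hx
  have := norm_le_gronwallBound_of_norm_deriv_right_le (f := fun x => (u x, v x))
    (f' := fun x => (v x, ((V x : ℂ) - z) * u x)) (δ := ‖(u 0, v 0)‖) (K := L) (ε := 0)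
    (a := 0) (b := s) (h.continuousOn.prodMk (h.continuousOn_deriv hs)) (fun y hy => by
      have hy' := Ico_subset_Icc_self hy
      have hI : Icc 0 s ∈ nhdsWithin y (Ici y) :=
        Filter.mem_of_superset (Icc_mem_nhdsGE hy.2) (Icc_subset_Icc_left hy.1)
      exact ((h.hasDeriv y hy').mono_of_mem_nhdsWithin hI).prodMk
        ((hd y hy').mono_of_mem_nhdsWithin hI)) le_rfl (fun y hy => by
      have hy' := Ico_subset_Icc_self hy
      simp only [Prod.norm_def, norm_mul, add_zero]
      refine max_le ?_ ?_
      · exact (le_max_right _ _).trans (le_mul_of_one_le_left (by positivity) hL)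
      · exact mul_le_mul (hVL y hy') (le_max_left _ _) (norm_nonneg _) (zero_le_one.trans hL))
    x hx
  simpa [gronwallBound_ε0] using this

end UnderSampling

/-! ### Volterra operators, existence of `ξ`, the Neumann resolvent. -/

namespace UnderSampling

open scoped Classical in
/-- The derivative of `xi V s z`. -/
noncomputable def dxi (V : ℝ → ℝ) (s : ℝ) (z : ℂ) : ℝ → ℂ :=
  if h : ∃ v, TauEq V s (xi V s z) v (fun x => z * xi V s z x) ∧ xi V s z 0 = 1 ∧ v 0 = 0
  then h.choose else 0

variable {V : ℝ → ℝ} {s : ℝ} {z : ℂ}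

theorem integrableOn_L2 (h : L2 s) : IntegrableOn h (Ioo 0 s) :=
  (Lp.memLp h).integrable (by norm_num)

theorem intervalIntegrable_L2 (hs : 0 ≤ s) (h : L2 s) : IntervalIntegrable h volume 0 s :=
  (intervalIntegrable_iff_integrableOn_Ioo_of_le hs).mpr (integrableOn_L2 h)

theorem intervalIntegrable_L2' (hs : 0 ≤ s) (h : L2 s) {x y : ℝ} (hx : x ∈ Icc 0 s)
    (hy : y ∈ Icc 0 s) : IntervalIntegrable h volume x y :=
  (intervalIntegrable_L2 hs h).mono_set
    (uIcc_subset_uIcc (by rwa [uIcc_of_le hs]) (by rwa [uIcc_of_le hs]))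

/-- Cauchy–Schwarz against the indicator of `(x,y)`. The resulting modulus of continuity makes the
Volterra operator compact. -/
theorem norm_integral_L2_le_of_le (h : L2 s) {x y : ℝ} (hx : 0 ≤ x) (hxy : x ≤ y) (hy : y ≤ s) :
    ‖∫ t in x..y, h t‖ ≤ √(y - x) * ‖h‖ := by
  have hm : (volume : Measure ℝ).restrict (Ioo 0 s) (Ioo x y) ≠ ⊤ := measure_ne_top _ _
  have e1 : ∫ t in x..y, h t = ∫ t in Ioo x y, h t ∂((volume : Measure ℝ).restrict (Ioo 0 s)) := by
    rw [intervalIntegral.integral_of_le hxy, integral_Ioc_eq_integral_Ioo,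
      Measure.restrict_restrict measurableSet_Ioo,
      inter_eq_left.mpr (Ioo_subset_Ioo hx hy)]
  have e2 := L2.inner_indicatorConstLp_one (𝕜 := ℂ) measurableSet_Ioo hm h
  rw [e1, ← e2]
  refine (norm_inner_le_norm _ _).trans (mul_le_mul_of_nonneg_right ?_ (norm_nonneg _))
  rw [norm_indicatorConstLp (by norm_num) (by norm_num), norm_one, one_mul, Real.sqrt_eq_rpow]
  have e3 : 1 / ENNReal.toReal 2 = 1 / 2 := by norm_num
  rw [e3]
  refine Real.rpow_le_rpow measureReal_nonneg (le_of_eq ?_) (by norm_num)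
  rw [measureReal_restrict_apply measurableSet_Ioo, inter_eq_left.mpr (Ioo_subset_Ioo hx hy),
    Real.volume_real_Ioo_of_le hxy]

theorem norm_integral_L2_le (h : L2 s) {x y : ℝ} (hx : x ∈ Icc 0 s) (hy : y ∈ Icc 0 s) :
    ‖∫ t in x..y, h t‖ ≤ √|y - x| * ‖h‖ := by
  rcases le_total x y with hxy | hxy
  · rw [abs_of_nonneg (sub_nonneg.mpr hxy)]
    exact norm_integral_L2_le_of_le h hx.1 hxy hy.2
  · rw [intervalIntegral.integral_symm, norm_neg, abs_sub_comm,
      abs_of_nonneg (sub_nonneg.mpr hxy)]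
    exact norm_integral_L2_le_of_le h hy.1 hxy hx.2

theorem integral_L2_sub (hs : 0 ≤ s) (h : L2 s) {x y : ℝ} (hx : x ∈ Icc 0 s) (hy : y ∈ Icc 0 s) :
    (∫ t in 0..y, h t) - ∫ t in 0..x, h t = ∫ t in x..y, h t := by
  have h0 : (0 : ℝ) ∈ Icc 0 s := left_mem_Icc.mpr hs
  exact intervalIntegral.integral_interval_sub_left (intervalIntegrable_L2' hs h h0 hy)
    (intervalIntegrable_L2' hs h h0 hx)

theorem integral_congr_Ioo {x : ℝ} (hx : x ∈ Icc 0 s) {f g : ℝ → ℂ}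
    (h : ∀ᵐ t, t ∈ Ioo 0 s → f t = g t) : ∫ t in 0..x, f t = ∫ t in 0..x, g t := by
  have hne : ∀ᵐ t : ℝ, t ≠ s := by simp [ae_iff, measure_singleton]
  refine intervalIntegral.integral_congr_ae ?_
  filter_upwards [h, hne] with t ht hts hm
  rw [uIoc_of_le hx.1] at hm
  exact ht ⟨hm.1, lt_of_le_of_ne (hm.2.trans hx.2) hts⟩

/-- The Volterra operator `h ↦ (x ↦ ∫₀ˣ h)` from `L₂(0,s)` to the continuous functions. -/
noncomputable def volterra (hs : 0 ≤ s) : L2 s →L[ℂ] C(Icc (0 : ℝ) s, ℂ) :=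
  LinearMap.mkContinuous
    { toFun h := ⟨fun x => ∫ t in 0..(x : ℝ), h t,
        ((absCont_integral (intervalIntegrable_L2 hs h)).continuousOn.mono
          (by rw [uIcc_of_le hs])).domRestrict⟩
      map_add' f g := by
        ext x
        have h0 : (0 : ℝ) ∈ Icc 0 s := left_mem_Icc.mpr hs
        change ∫ t in 0..(x : ℝ), (f + g) t = (∫ t in 0..(x : ℝ), f t) + ∫ t in 0..(x : ℝ), g t
        rw [← intervalIntegral.integral_add (intervalIntegrable_L2' hs f h0 x.2)
          (intervalIntegrable_L2' hs g h0 x.2)]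
        exact integral_congr_Ioo x.2
          ((ae_restrict_iff' measurableSet_Ioo).mp (Lp.coeFn_add f g))
      map_smul' c f := by
        ext x
        change ∫ t in 0..(x : ℝ), (c • f) t = c • ∫ t in 0..(x : ℝ), f t
        rw [← intervalIntegral.integral_smul]
        exact integral_congr_Ioo x.2
          ((ae_restrict_iff' measurableSet_Ioo).mp (Lp.coeFn_smul c f)) }
    √s fun h => by
      refine (ContinuousMap.norm_le _ (by positivity)).mpr fun x => ?_
      refine (norm_integral_L2_le h (left_mem_Icc.mpr hs) x.2).trans
        (mul_le_mul_of_nonneg_right (Real.sqrt_le_sqrt ?_) (norm_nonneg _))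
      rw [sub_zero, abs_of_nonneg x.2.1]
      exact x.2.2

theorem volterra_apply (hs : 0 ≤ s) (h : L2 s) (x : Icc (0 : ℝ) s) :
    volterra hs h x = ∫ t in 0..(x : ℝ), h t := rfl

/-- Arzelà–Ascoli: the image of the unit ball is bounded by `√s` and has the common modulus `√|x -
y|`. The set `P` of all functions with these two bounds is closed in a product of discs, hence
compact for pointwise convergence, and its members are automatically continuous. -/
theorem isCompactOperator_volterra (hs : 0 ≤ s) : IsCompactOperator (volterra hs) := by
  refine (isCompactOperator_iff_image_closedBall_subset_compact
    (volterra hs).toLinearMap one_pos).mpr ?_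
  set P : Set (Icc (0 : ℝ) s → ℂ) :=
    {f | (∀ x, f x ∈ Metric.closedBall (0 : ℂ) √s) ∧
      ∀ x y, dist (f x) (f y) ≤ √|(x : ℝ) - y|} with hP
  have hcont : ∀ f ∈ P, ∀ x, ContinuousAt f x := fun f hf x => by
    refine tendsto_iff_dist_tendsto_zero.mpr
      (squeeze_zero (fun _ => dist_nonneg) (fun y => hf.2 y x) ?_)
    have : Continuous fun y : Icc (0 : ℝ) s => √|(y : ℝ) - x| := by fun_prop
    simpa using this.tendsto x
  have hPc : IsCompact P := by
    refine (isCompact_univ_pi fun _ => isCompact_closedBall (0 : ℂ) √s).of_isClosed_subset ?_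
      (fun f hf x _ => hf.1 x)
    have : P = (⋂ x, {f | f x ∈ Metric.closedBall (0 : ℂ) √s}) ∩
        ⋂ x : Icc (0 : ℝ) s, ⋂ y : Icc (0 : ℝ) s, {f | dist (f x) (f y) ≤ √|(x : ℝ) - y|} := by
      ext f
      simp only [hP, mem_inter_iff, mem_iInter, mem_ofPred_eq]
    rw [this]
    refine (isClosed_iInter fun x =>
      Metric.isClosed_closedBall.preimage (continuous_apply x)).inter
      (isClosed_iInter fun x => isClosed_iInter fun y =>
        isClosed_le ((continuous_apply x).dist (continuous_apply y)) continuous_const)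
  refine ⟨{f | (f : Icc (0 : ℝ) s → ℂ) ∈ P}, ?_, ?_⟩
  · refine ArzelaAscoli.isCompact_of_equicontinuous _ ?_ ?_
    · convert hPc using 1
      ext f
      constructor
      · rintro ⟨g, hg, rfl⟩; exact hg
      · exact fun hf => ⟨⟨f, continuous_iff_continuousAt.mpr (hcont f hf)⟩, hf, rfl⟩
    · intro x
      refine Metric.equicontinuousAt_of_continuity_modulus
        (fun y : Icc (0 : ℝ) s => √|(x : ℝ) - y|) ?_ _
        (Filter.Eventually.of_forall fun y f => f.2.2 x y)
      have : Continuous fun y : Icc (0 : ℝ) s => √|(x : ℝ) - y| := by fun_prop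
      simpa using this.tendsto x
  · rintro _ ⟨h, hh, rfl⟩
    have hh' : ‖h‖ ≤ 1 := by simpa using hh
    refine ⟨fun x => ?_, fun x y => ?_⟩
    · rw [mem_closedBall_zero_iff]
      refine (norm_integral_L2_le h (left_mem_Icc.mpr hs) x.2).trans ?_
      refine (mul_le_of_le_one_right (Real.sqrt_nonneg _) hh').trans (Real.sqrt_le_sqrt ?_)
      rw [sub_zero, abs_of_nonneg x.2.1]
      exact x.2.2
    · rw [dist_eq_norm]
      change ‖volterra hs h x - volterra hs h y‖ ≤ _
      rw [volterra_apply, volterra_apply, integral_L2_sub hs h y.2 x.2]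
      exact (norm_integral_L2_le h y.2 x.2).trans
        (mul_le_of_le_one_right (Real.sqrt_nonneg _) hh')

theorem memLp_extend (hs : 0 ≤ s) (f : C(Icc (0 : ℝ) s, ℂ)) :
    MemLp (IccExtend hs f) 2 ((volume : Measure ℝ).restrict (Ioo 0 s)) :=
  MemLp.of_bound (f.continuous.Icc_extend' (h := hs)).aestronglyMeasurable ‖f‖
    (Filter.Eventually.of_forall fun _ => f.norm_coe_le_norm _)

/-- The inclusion of the continuous functions on `[0,s]` into `L₂(0,s)`. -/
noncomputable def inclL2 (hs : 0 ≤ s) : C(Icc (0 : ℝ) s, ℂ) →L[ℂ] L2 s :=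
  LinearMap.mkContinuous
    { toFun f := (memLp_extend hs f).toLp _
      map_add' f g := by rw [← MemLp.toLp_add]; rfl
      map_smul' c f := by rw [RingHom.id_apply, ← MemLp.toLp_const_smul]; rfl }
    (((volume : Measure ℝ).restrict (Ioo 0 s)).real univ ^ (ENNReal.toReal 2)⁻¹) fun f => by
      refine Lp.norm_le_of_ae_bound (norm_nonneg _) ?_
      filter_upwards [(memLp_extend hs f).coeFn_toLp] with x hx
      refine (congrArg norm hx).le.trans (f.norm_coe_le_norm _)

theorem inclL2_ae (hs : 0 ≤ s) (f : C(Icc (0 : ℝ) s, ℂ)) :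
    ∀ᵐ x, x ∈ Ioo 0 s → inclL2 hs f x = IccExtend hs f x :=
  (ae_restrict_iff' measurableSet_Ioo).mp (memLp_extend hs f).coeFn_toLp

/-- A function `α + ∫₀ˣ ∫₀ʸ w` with `w ∈ L₂(0,s)` has absolutely continuous derivative `∫₀ˣ w`. -/
theorem tauEq_volterra (hs : 0 ≤ s) (V : ℝ → ℝ) (α : ℂ) (w : L2 s) {η : ℝ → ℂ}
    {f : C(Icc (0 : ℝ) s, ℂ)} (hf : ∀ x, f x = α + volterra hs (inclL2 hs (volterra hs w)) x)
    (hη : ∀ᵐ x, x ∈ Ioo 0 s → (V x : ℂ) * IccExtend hs f x - w x = η x) :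
    TauEq V s (IccExtend hs f) (fun x => ∫ t in 0..x, w t) η where
  hasDeriv := by
    set g := IccExtend hs (volterra hs w) with hg
    have hgc : Continuous g := (volterra hs w).continuous.Icc_extend'
    have e1 : ∀ x ∈ Icc 0 s, IccExtend hs f x = α + ∫ t in 0..x, g t := by
      intro x hx
      rw [IccExtend_of_mem hs f hx, hf, volterra_apply]
      congr 1
      exact integral_congr_Ioo hx (inclL2_ae hs _)
    intro x hx
    have e2 : g x = ∫ t in 0..x, w t := by
      rw [hg, IccExtend_of_mem hs _ hx]; rfl
    rw [← e2]
    exact ((hgc.integral_hasStrictDerivAt 0 x).hasDerivAt.const_add α).hasDerivWithinAt.congr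
      e1 (e1 x hx)
  absCont := absCont_integral (intervalIntegrable_L2 hs w)
  eqn := by
    filter_upwards [hη, (intervalIntegrable_L2 hs w).ae_hasDerivAt_integral] with x h1 h2 hx
    refine ⟨w x, h2 (by rw [uIcc_of_le hs]; exact Ioo_subset_Icc_self hx) 0 left_mem_uIcc, ?_⟩
    rw [← h1 hx]
    ring

/-- The function `V - z` on `[0,s]`. -/
noncomputable def shifted (hV : ContinuousOn V (Icc 0 s)) (z : ℂ) : C(Icc (0 : ℝ) s, ℂ) :=
  ⟨fun x => (V x : ℂ) - z,
    ((continuousOn_potential hV).sub continuousOn_const).domRestrict⟩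

/-- The operator `f ↦ (V - z) f` from the continuous functions to `L₂(0,s)`. -/
noncomputable def shiftedMul (hs : 0 ≤ s) (hV : ContinuousOn V (Icc 0 s)) (z : ℂ) :
    C(Icc (0 : ℝ) s, ℂ) →L[ℂ] L2 s :=
  (inclL2 hs).comp (ContinuousLinearMap.mul ℂ C(Icc (0 : ℝ) s, ℂ) (shifted hV z))

theorem shiftedMul_ae (hs : 0 ≤ s) (hV : ContinuousOn V (Icc 0 s)) (z : ℂ)
    (f : C(Icc (0 : ℝ) s, ℂ)) :
    ∀ᵐ x, x ∈ Ioo 0 s → shiftedMul hs hV z f x = ((V x : ℂ) - z) * IccExtend hs f x := by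
  filter_upwards [inclL2_ae hs (shifted hV z * f)] with x h hx
  refine (h hx).trans ?_
  have hx' := Ioo_subset_Icc_self hx
  rw [IccExtend_of_mem hs _ hx', IccExtend_of_mem hs _ hx']
  rfl

/-- Twofold integration. -/
noncomputable def volterraSq (hs : 0 ≤ s) : L2 s →L[ℂ] C(Icc (0 : ℝ) s, ℂ) :=
  (volterra hs).comp ((inclL2 hs).comp (volterra hs))

theorem isCompactOperator_volterraSq (hs : 0 ≤ s) : IsCompactOperator (volterraSq hs) :=
  (isCompactOperator_volterra hs).comp_clm ((inclL2 hs).comp (volterra hs))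

theorem volterra_zero (hs : 0 ≤ s) (w : L2 s) : volterra hs w ⟨0, left_mem_Icc.mpr hs⟩ = 0 := by
  rw [volterra_apply, intervalIntegral.integral_same]

/-- A fixed point of the compact operator `f ↦ ∫∫ (V - z) f` solves `τ f = z f` with zero initial
data, hence vanishes by Gronwall. So `1` is not an eigenvalue, and the Fredholm alternative gives
invertibility. -/
theorem isUnit_one_sub_volterra (hs : 0 ≤ s) (hV : ContinuousOn V (Icc 0 s)) (z : ℂ) :
    IsUnit (1 - (volterraSq hs).comp (shiftedMul hs hV z)) := by
  set K := (volterraSq hs).comp (shiftedMul hs hV z) with hK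
  have hKc : IsCompactOperator K :=
    (isCompactOperator_volterraSq hs).comp_clm (shiftedMul hs hV z)
  rcases hKc.hasEigenvalue_or_mem_resolventSet (one_ne_zero : (1 : ℂ) ≠ 0) with h | h
  · exfalso
    obtain ⟨f, hf⟩ := h.exists_hasEigenvector
    have hfK : K f = f := by simpa using hf.apply_eq_smul
    have hfx : ∀ x, f x = 0 + volterra hs (inclL2 hs (volterra hs (shiftedMul hs hV z f))) x := by
      intro x
      rw [zero_add]
      exact (DFunLike.congr_fun hfK x).symm
    have ht := tauEq_volterra hs V 0 (shiftedMul hs hV z f) (η := fun x => z * IccExtend hs f x)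
      hfx (by
        filter_upwards [shiftedMul_ae hs hV z f] with x hx hxm
        rw [hx hxm]
        ring)
    obtain ⟨C, hC⟩ := isCompact_Icc.exists_bound_of_continuousOn
      ((continuousOn_potential hV).sub (continuousOn_const (c := z)))
    refine hf.2 (ContinuousMap.ext fun x => ?_)
    have h0 : IccExtend hs f 0 = 0 := by
      rw [IccExtend_of_mem hs f (left_mem_Icc.mpr hs), hfx, volterra_zero, zero_add]
    have := ht.norm_le hs hV (le_max_left 1 C) (fun x hx => (hC x hx).trans (le_max_right _ _))
      x x.2
    rw [h0, intervalIntegral.integral_same, ← Prod.zero_eq_mk, norm_zero, zero_mul] at this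
    have h2 := (Prod.mk_eq_zero.mp (norm_le_zero_iff.mp this)).1
    rwa [IccExtend_of_mem hs f x.2] at h2
  · simpa [spectrum.mem_resolventSet_iff] using h

/-- The initial value problem is the integral equation `ξ = 1 + ∫∫ (V - z) ξ`, solved by applying
the inverse to the constant `1`. -/
theorem exists_isXi (hs : 0 ≤ s) (hV : ContinuousOn V (Icc 0 s)) (z : ℂ) :
    ∃ u, IsXi V s z u := by
  obtain ⟨A, hA⟩ := (isUnit_one_sub_volterra hs hV z).exists_right_inv
  set K := (volterraSq hs).comp (shiftedMul hs hV z) with hK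
  set f := A 1 with hf
  have hfx : ∀ x, f x = 1 + volterra hs (inclL2 hs (volterra hs (shiftedMul hs hV z f))) x := by
    intro x
    have : f - K f = 1 := by simpa using DFunLike.congr_fun hA (1 : C(Icc (0 : ℝ) s, ℂ))
    have := DFunLike.congr_fun this x
    simp only [ContinuousMap.sub_apply, ContinuousMap.one_apply] at this
    rw [← this]
    simp [hK, volterraSq]
  refine ⟨IccExtend hs f, fun x => ∫ t in 0..x, shiftedMul hs hV z f t,
    tauEq_volterra hs V 1 (shiftedMul hs hV z f) hfx ?_, ?_, by simp⟩
  · filter_upwards [shiftedMul_ae hs hV z f] with x hx hxm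
    rw [hx hxm]
    ring
  · rw [IccExtend_of_mem hs f (left_mem_Icc.mpr hs), hfx, volterra_zero, add_zero]

theorem dxi_spec (hs : 0 ≤ s) (hV : ContinuousOn V (Icc 0 s)) (z : ℂ) :
    TauEq V s (xi V s z) (dxi V s z) (fun x => z * xi V s z x) ∧ xi V s z 0 = 1 ∧
      dxi V s z 0 = 0 := by
  have h : ∃ v, TauEq V s (xi V s z) v (fun x => z * xi V s z x) ∧ xi V s z 0 = 1 ∧ v 0 = 0 := by
    have h := exists_isXi hs hV z
    have e : xi V s z = h.choose := by rw [xi, dif_pos h]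
    rw [e]
    exact h.choose_spec
  have e : dxi V s z = h.choose := by rw [dxi, dif_pos h]
  rw [e]
  exact h.choose_spec

/-- The difference `u - u(0) ξ` has zero initial data, so Gronwall applies. -/
theorem eq_const_mul_xi (hs : 0 ≤ s) (hV : ContinuousOn V (Icc 0 s)) {u v : ℝ → ℂ}
    (h : TauEq V s u v (fun x => z * u x)) (hv : v 0 = 0) :
    ∀ x ∈ Icc 0 s, u x = u 0 * xi V s z x ∧ v x = u 0 * dxi V s z x := by
  obtain ⟨h1, h2, h3⟩ := dxi_spec hs hV z
  have ht := (h.add (h1.const_mul (-u 0))).congr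
    (η₁ := fun x => z * (u x + -u 0 * xi V s z x))
    (Filter.Eventually.of_forall fun x _ => by ring)
  obtain ⟨C, hC⟩ := isCompact_Icc.exists_bound_of_continuousOn
    ((continuousOn_potential hV).sub (continuousOn_const (c := z)))
  intro x hx
  have := ht.norm_le hs hV (le_max_left 1 C) (fun x hx => (hC x hx).trans (le_max_right _ _)) x hx
  rw [h2, hv, h3, mul_one, mul_zero, add_zero, add_neg_cancel, ← Prod.zero_eq_mk, norm_zero,
    zero_mul] at this
  have h4 := Prod.mk_eq_zero.mp (norm_le_zero_iff.mp this)
  exact ⟨by linear_combination h4.1, by linear_combination h4.2⟩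

/-- The solutions on the two intervals are chosen independently; uniqueness identifies them. -/
theorem xi_restrict {s' : ℝ} (hs : 0 ≤ s) (hss : s ≤ s') (hV : ContinuousOn V (Icc 0 s')) (z : ℂ) :
    EqOn (xi V s' z) (xi V s z) (Icc 0 s) := by
  obtain ⟨h1, h2, h3⟩ := dxi_spec (hs.trans hss) hV z
  intro x hx
  have := (eq_const_mul_xi hs (hV.mono (Icc_subset_Icc_right hss)) (h1.mono hs hss) h3 x hx).1
  rwa [h2, one_mul] at this

theorem mem_hGraph_of_tauEq {p : L2 s × L2 s} {u v η : ℝ → ℂ} (h : TauEq V s u v η)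
    (hη : ∀ᵐ x, x ∈ Ioo 0 s → η x = p.2 x) (hu : ∀ᵐ x, x ∈ Ioo 0 s → p.1 x = u x)
    (h0 : v 0 = 0) (h1 : v s = 0) : p ∈ hGraph V s (Real.pi / 2) :=
  ⟨u, v, h.congr hη, hu, h0, by simp [h1]⟩

/-- The Neumann problem is solvable at every `z` with `ξ'(s,z) ≠ 0`, with compact solution
operator. -/
theorem exists_resolvent (hs : 0 ≤ s) (hV : ContinuousOn V (Icc 0 s)) (hz : dxi V s z s ≠ 0) :
    ∃ R : L2 s →L[ℂ] L2 s, IsCompactOperator R ∧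
      ∀ h, (R h, h + z • R h) ∈ hGraph V s (Real.pi / 2) := by
  obtain ⟨A, hA⟩ := (isUnit_one_sub_volterra hs hV z).exists_right_inv
  set K := (volterraSq hs).comp (shiftedMul hs hV z) with hK
  obtain ⟨hx1, hx2, hx3⟩ := dxi_spec hs hV z
  -- `y = S h` is the particular solution of `τ y = z y + h` with zero initial data, that is, of `y
  -- = ∫∫ ((V - z) y - h)`. Below, `w h` is `y''`.
  set S : L2 s →L[ℂ] C(Icc (0 : ℝ) s, ℂ) := -(A.comp (volterraSq hs)) with hS
  set w : L2 s →L[ℂ] L2 s := (shiftedMul hs hV z).comp S - 1 with hw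
  set e : C(Icc (0 : ℝ) s, ℂ) →L[ℂ] ℂ :=
    ContinuousMap.evalCLM ℂ ⟨s, right_mem_Icc.mpr hs⟩ with he
  -- Since `y'(s) = ∫₀ˢ w h`, adding `c h` times `ξ` cancels the derivative at `s` and leaves the
  -- one at `0` equal to zero.
  set c : L2 s →L[ℂ] ℂ := (-(dxi V s z s)⁻¹) • e.comp ((volterra hs).comp w) with hc
  have hSx : ∀ h x, S h x = 0 + volterra hs (inclL2 hs (volterra hs (w h))) x := by
    intro h x
    have e1 : S h - K (S h) = -volterraSq hs h := by
      have := DFunLike.congr_fun hA (-volterraSq hs h)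
      simpa [hS] using this
    have e2 : S h = volterraSq hs (w h) := by
      have : volterraSq hs (w h) = K (S h) - volterraSq hs h := by simp [hw, hK]
      rw [this]
      linear_combination e1
    rw [zero_add]
    exact DFunLike.congr_fun e2 x
  refine ⟨(inclL2 hs).comp S + (ContinuousLinearMap.toSpanSingleton ℂ (xiL2 V s z)).comp c,
    ?_, fun h => ?_⟩
  · have hSc : IsCompactOperator S := by
      rw [hS]
      exact ((isCompactOperator_volterraSq hs).clm_comp A).neg
    refine IsCompactOperator.add (hSc.clm_comp (inclL2 hs)) ?_
    exact (isCompactOperator_of_locallyCompactSpace_rng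
      (ContinuousLinearMap.toSpanSingleton ℂ (xiL2 V s z))).comp_clm c
  · set R := (inclL2 hs).comp S + (ContinuousLinearMap.toSpanSingleton ℂ (xiL2 V s z)).comp c
    have hR : R h = inclL2 hs (S h) + c h • xiL2 V s z := by simp [R]
    have hRae : ∀ᵐ x, x ∈ Ioo 0 s → R h x = IccExtend hs (S h) x + c h * xi V s z x := by
      have i1 := (ae_restrict_iff' measurableSet_Ioo).mp
        (Lp.coeFn_add (inclL2 hs (S h)) (c h • xiL2 V s z))
      have i2 := (ae_restrict_iff' measurableSet_Ioo).mp (Lp.coeFn_smul (c h) (xiL2 V s z))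
      have i3 := (ae_restrict_iff' measurableSet_Ioo).mp (memLp_xi V s z).coeFn_toLp
      filter_upwards [i1, i2, i3, inclL2_ae hs (S h)] with x h1 h2 h3 h4 hx
      rw [hR, h1 hx, Pi.add_apply, h2 hx, Pi.smul_apply, h4 hx, xiL2, h3 hx, smul_eq_mul]
    have hwae : ∀ᵐ x, x ∈ Ioo 0 s → w h x = ((V x : ℂ) - z) * IccExtend hs (S h) x - h x := by
      have i1 := (ae_restrict_iff' measurableSet_Ioo).mp
        (Lp.coeFn_sub (shiftedMul hs hV z (S h)) h)
      filter_upwards [i1, shiftedMul_ae hs hV z (S h)] with x h1 h2 hx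
      have : w h = shiftedMul hs hV z (S h) - h := by simp [hw]
      rw [this, h1 hx, Pi.sub_apply, h2 hx]
    have ht := (tauEq_volterra hs V 0 (w h) (η := fun x => z * IccExtend hs (S h) x + h x)
      (hSx h) (by
        filter_upwards [hwae] with x hx hxm
        rw [hx hxm]
        ring)).add (hx1.const_mul (c h))
    refine mem_hGraph_of_tauEq ht ?_ hRae ?_ ?_
    · have i1 := (ae_restrict_iff' measurableSet_Ioo).mp (Lp.coeFn_add h (z • R h))
      have i2 := (ae_restrict_iff' measurableSet_Ioo).mp (Lp.coeFn_smul z (R h))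
      filter_upwards [i1, i2, hRae] with x h1 h2 h3 hx
      rw [h1 hx, Pi.add_apply, h2 hx, Pi.smul_apply, h3 hx, smul_eq_mul]
      ring
    · rw [hx3, intervalIntegral.integral_same, mul_zero, add_zero]
    · have : c h = -(dxi V s z s)⁻¹ * ∫ t in 0..s, w h t := rfl
      rw [this]
      field_simp
      ring

end UnderSampling

/-! ### The Neumann operator: symmetry, energy, spectrum, completeness. -/

namespace UnderSampling

variable {V : ℝ → ℝ} {s : ℝ} {z : ℂ}

theorem exists_rep {p : L2 s × L2 s} (hp : p ∈ hGraph V s (Real.pi / 2)) :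
    ∃ u v : ℝ → ℂ, TauEq V s u v p.2 ∧ (∀ᵐ x, x ∈ Ioo 0 s → p.1 x = u x) ∧ v 0 = 0 ∧ v s = 0 := by
  obtain ⟨u, v, h, hu, h0, h1⟩ := hp
  exact ⟨u, v, h, hu, h0, by simpa using h1⟩

theorem inner_L2_eq (hs : 0 ≤ s) {f g : L2 s} {u w : ℝ → ℂ}
    (hu : ∀ᵐ x, x ∈ Ioo 0 s → f x = u x) (hw : ∀ᵐ x, x ∈ Ioo 0 s → g x = w x) :
    ⟪f, g⟫_ℂ = ∫ x in 0..s, conj (u x) * w x := by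
  rw [L2.inner_def, intervalIntegral.integral_of_le hs, integral_Ioc_eq_integral_Ioo]
  refine integral_congr_ae ((ae_restrict_iff' measurableSet_Ioo).mpr ?_)
  filter_upwards [hu, hw] with x h1 h2 hx
  rw [h1 hx, h2 hx, RCLike.inner_apply, mul_comm]

theorem eventually_self (f : L2 s) : ∀ᵐ x, x ∈ Ioo 0 s → f x = f x :=
  Filter.Eventually.of_forall fun _ _ => rfl

theorem intervalIntegrable_conj {u : ℝ → ℂ} {a b : ℝ} (hu : IntervalIntegrable u volume a b) :
    IntervalIntegrable (fun x => conj (u x)) volume a b :=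
  ⟨Complex.conjLIE.toContinuousLinearEquiv.toContinuousLinearMap.integrable_comp hu.1,
    Complex.conjLIE.toContinuousLinearEquiv.toContinuousLinearMap.integrable_comp hu.2⟩

/-- The Neumann operator is symmetric. -/
theorem inner_hGraph_symm (hs : 0 ≤ s) (hV : ContinuousOn V (Icc 0 s)) {p q : L2 s × L2 s}
    (hp : p ∈ hGraph V s (Real.pi / 2)) (hq : q ∈ hGraph V s (Real.pi / 2)) :
    ⟪p.2, q.1⟫_ℂ = ⟪p.1, q.2⟫_ℂ := by
  obtain ⟨u₁, v₁, h₁, hu₁, ha₁, hb₁⟩ := exists_rep hp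
  obtain ⟨u₂, v₂, h₂, hu₂, ha₂, hb₂⟩ := exists_rep hq
  rw [inner_L2_eq hs (eventually_self _) hu₂, inner_L2_eq hs hu₁ (eventually_self _)]
  simpa [ha₁, hb₁, ha₂, hb₂] using h₁.conj.green hs hV h₂
    (intervalIntegrable_conj (intervalIntegrable_L2 hs _)) (intervalIntegrable_L2 hs _)

theorem norm_sq_eq_integral (hs : 0 ≤ s) {f : L2 s} {u : ℝ → ℂ}
    (hu : ∀ᵐ x, x ∈ Ioo 0 s → f x = u x) : ‖f‖ ^ 2 = ∫ x in 0..s, ‖u x‖ ^ 2 := by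
  have h1 : ((‖f‖ ^ 2 : ℝ) : ℂ) = ((∫ x in 0..s, ‖u x‖ ^ 2 : ℝ) : ℂ) := by
    rw [← intervalIntegral.integral_ofReal]
    push_cast
    refine (inner_self_eq_norm_sq_to_K (𝕜 := ℂ) f).symm.trans ((inner_L2_eq hs hu hu).trans ?_)
    congr 1
    ext x
    exact Complex.conj_mul' (u x)
  exact_mod_cast h1

theorem inner_hGraph_eq_energy (hs : 0 ≤ s) (hV : ContinuousOn V (Icc 0 s)) {p : L2 s × L2 s}
    {u v : ℝ → ℂ} (h : TauEq V s u v p.2) (hu : ∀ᵐ x, x ∈ Ioo 0 s → p.1 x = u x)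
    (h0 : v 0 = 0) (h1 : v s = 0) :
    ⟪p.2, p.1⟫_ℂ = ((∫ x in 0..s, (‖v x‖ ^ 2 + V x * ‖u x‖ ^ 2) : ℝ) : ℂ) := by
  rw [inner_L2_eq hs (eventually_self _) hu]
  have key := h.conj.integral_form hs hV h (intervalIntegrable_conj (intervalIntegrable_L2 hs _))
  simp only [h0, h1, map_zero, zero_mul, sub_zero, add_zero] at key
  rw [← key, ← intervalIntegral.integral_ofReal]
  congr 1
  ext x
  rw [mul_assoc, Complex.conj_mul', Complex.conj_mul']
  push_cast
  ring

/-- Write `|u(0)|² = |u(x)|² - ∫₀ˣ (|u|²)'`, bound the integrand by `|u|² + |v|²`, and average over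
`x` in `[0,s]`. -/
theorem TauEq.trace_le (hs : 0 < s) {u v η : ℝ → ℂ} (h : TauEq V s u v η) :
    ‖u 0‖ ^ 2 ≤ (1 + 1 / s) * ∫ x in 0..s, (‖u x‖ ^ 2 + ‖v x‖ ^ 2) := by
  have hc := h.continuousOn
  have hd := h.continuousOn_deriv hs.le
  have hcu : ContinuousOn (fun x => ‖u x‖ ^ 2) (Icc 0 s) := hc.norm.pow 2
  have hcv : ContinuousOn (fun x => ‖v x‖ ^ 2) (Icc 0 s) := hd.norm.pow 2
  have hi : ∀ {f : ℝ → ℝ}, ContinuousOn f (Icc 0 s) → IntervalIntegrable f volume 0 s :=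
    fun hf => ContinuousOn.intervalIntegrable (by rwa [uIcc_of_le hs.le])
  set Q := ∫ x in 0..s, (‖u x‖ ^ 2 + ‖v x‖ ^ 2) with hQ
  have key : ∀ x ∈ Icc 0 s, ‖u 0‖ ^ 2 ≤ ‖u x‖ ^ 2 + Q := by
    intro x hx
    have hsub : Icc 0 x ⊆ Icc 0 s := Icc_subset_Icc_right hx.2
    have hcg : ContinuousOn (fun y => 2 * ⟪u y, v y⟫_ℝ) (Icc 0 s) :=
      continuousOn_const.mul (hc.inner hd)
    have hint : ∫ y in 0..x, 2 * ⟪u y, v y⟫_ℝ = ‖u x‖ ^ 2 - ‖u 0‖ ^ 2 := by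
      refine intervalIntegral.integral_eq_sub_of_hasDerivAt_of_le hx.1 (hcu.mono hsub)
        (fun y hy => ?_)
        ((hi hcg).mono_set (by rwa [uIcc_of_le hx.1, uIcc_of_le hs.le]))
      exact ((h.hasDeriv y (hsub (Ioo_subset_Icc_self hy))).hasDerivAt
        (Icc_mem_nhds hy.1 (hy.2.trans_le hx.2))).norm_sq
    have h2 : -∫ y in 0..x, 2 * ⟪u y, v y⟫_ℝ ≤ ∫ y in 0..x, (‖u y‖ ^ 2 + ‖v y‖ ^ 2) := by
      rw [← intervalIntegral.integral_neg]
      refine intervalIntegral.integral_mono_on hx.1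
        ((hi hcg).mono_set (by rwa [uIcc_of_le hx.1, uIcc_of_le hs.le])).neg
        ((hi (hcu.add hcv)).mono_set (by rwa [uIcc_of_le hx.1, uIcc_of_le hs.le])) fun y _ => ?_
      have := abs_real_inner_le_norm (u y) (v y)
      have := neg_abs_le (⟪u y, v y⟫_ℝ)
      nlinarith [sq_nonneg (‖u y‖ - ‖v y‖)]
    have h3 : ∫ y in 0..x, (‖u y‖ ^ 2 + ‖v y‖ ^ 2) ≤ Q :=
      intervalIntegral.integral_mono_interval le_rfl hx.1 hx.2
        (Filter.Eventually.of_forall fun y => by positivity) (hi (hcu.add hcv))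
    linarith
  have h4 : s * ‖u 0‖ ^ 2 ≤ (∫ x in 0..s, ‖u x‖ ^ 2) + s * Q := by
    have := intervalIntegral.integral_mono_on hs.le
      (intervalIntegrable_const (μ := volume) (c := ‖u 0‖ ^ 2))
      ((hi hcu).add (intervalIntegrable_const (c := Q))) key
    rw [intervalIntegral.integral_add (hi hcu) intervalIntegrable_const] at this
    simpa using this
  have h5 : ∫ x in 0..s, ‖u x‖ ^ 2 ≤ Q :=
    intervalIntegral.integral_mono_on hs.le (hi hcu) (hi (hcu.add hcv)) fun y _ =>
      le_add_of_nonneg_right (by positivity)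
  have h6 : (1 + 1 / s) * Q = (Q + s * Q) / s := by field_simp; ring
  rw [h6, le_div_iff₀ hs]
  linarith

theorem form_eq_integral (hs : 0 ≤ s) (hV : ContinuousOn V (Icc 0 s)) {c : ℝ} {p : L2 s × L2 s}
    {u v : ℝ → ℂ} (h : TauEq V s u v p.2) (hu : ∀ᵐ x, x ∈ Ioo 0 s → p.1 x = u x)
    (h0 : v 0 = 0) (h1 : v s = 0) :
    (⟪p.2, p.1⟫_ℂ).re + c * ‖p.1‖ ^ 2 = ∫ x in 0..s, (‖v x‖ ^ 2 + (V x + c) * ‖u x‖ ^ 2) := by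
  have hcu : ContinuousOn (fun x => ‖u x‖ ^ 2) (Icc 0 s) := h.continuousOn.norm.pow 2
  have hcv : ContinuousOn (fun x => ‖v x‖ ^ 2) (Icc 0 s) := (h.continuousOn_deriv hs).norm.pow 2
  have i1 : IntervalIntegrable (fun x => ‖v x‖ ^ 2 + V x * ‖u x‖ ^ 2) volume 0 s :=
    ContinuousOn.intervalIntegrable (by rw [uIcc_of_le hs]; exact hcv.add (hV.mul hcu))
  have i2 : IntervalIntegrable (fun x => c * ‖u x‖ ^ 2) volume 0 s :=
    ContinuousOn.intervalIntegrable (by rw [uIcc_of_le hs]; exact continuousOn_const.mul hcu)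
  rw [inner_hGraph_eq_energy hs hV h hu h0 h1, Complex.ofReal_re,
    norm_sq_eq_integral hs hu, ← intervalIntegral.integral_const_mul,
    ← intervalIntegral.integral_add i1 i2]
  congr 1
  ext x
  ring

/-- As `V + c ≥ 1`, the form of `H + c` dominates `∫ (|u|² + |v|²)`, which controls the value at
`0`. -/
theorem trace_le_form (hs : 0 < s) (hV : ContinuousOn V (Icc 0 s)) {c : ℝ}
    (hc : ∀ x ∈ Icc 0 s, 1 ≤ V x + c) {p : L2 s × L2 s}
    {u v : ℝ → ℂ} (h : TauEq V s u v p.2) (hu : ∀ᵐ x, x ∈ Ioo 0 s → p.1 x = u x)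
    (h0 : v 0 = 0) (h1 : v s = 0) :
    ‖u 0‖ ^ 2 ≤ (1 + 1 / s) * ((⟪p.2, p.1⟫_ℂ).re + c * ‖p.1‖ ^ 2) := by
  refine (h.trace_le hs).trans (mul_le_mul_of_nonneg_left ?_ (by positivity))
  have hcu : ContinuousOn (fun x => ‖u x‖ ^ 2) (Icc 0 s) := h.continuousOn.norm.pow 2
  have hcv : ContinuousOn (fun x => ‖v x‖ ^ 2) (Icc 0 s) := (h.continuousOn_deriv hs.le).norm.pow 2
  have hi : ∀ {f : ℝ → ℝ}, ContinuousOn f (Icc 0 s) → IntervalIntegrable f volume 0 s :=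
    fun hf => ContinuousOn.intervalIntegrable (by rwa [uIcc_of_le hs.le])
  rw [form_eq_integral hs.le hV h hu h0 h1]
  refine intervalIntegral.integral_mono_on hs.le (hi (hcu.add hcv))
    (hi (hcv.add ((hV.add continuousOn_const).mul hcu))) fun x hx => ?_
  nlinarith [hc x hx, sq_nonneg ‖u x‖]

/-- The Neumann operator is bounded below by `1 - c` if `V + c ≥ 1`. -/
theorem norm_sq_le_form (hs : 0 < s) (hV : ContinuousOn V (Icc 0 s)) {c : ℝ}
    (hc : ∀ x ∈ Icc 0 s, 1 ≤ V x + c) {p : L2 s × L2 s} (hp : p ∈ hGraph V s (Real.pi / 2)) :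
    ‖p.1‖ ^ 2 ≤ (⟪p.2, p.1⟫_ℂ).re + c * ‖p.1‖ ^ 2 := by
  obtain ⟨u, v, h, hu, h0, h1⟩ := exists_rep hp
  have hcu : ContinuousOn (fun x => ‖u x‖ ^ 2) (Icc 0 s) := h.continuousOn.norm.pow 2
  have hcv : ContinuousOn (fun x => ‖v x‖ ^ 2) (Icc 0 s) := (h.continuousOn_deriv hs.le).norm.pow 2
  have hi : ∀ {f : ℝ → ℝ}, ContinuousOn f (Icc 0 s) → IntervalIntegrable f volume 0 s :=
    fun hf => ContinuousOn.intervalIntegrable (by rwa [uIcc_of_le hs.le])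
  rw [form_eq_integral hs.le hV h hu h0 h1, norm_sq_eq_integral hs.le hu]
  refine intervalIntegral.integral_mono_on hs.le (hi hcu)
    (hi (hcv.add ((hV.add continuousOn_const).mul hcu))) fun x hx => ?_
  nlinarith [hc x hx, sq_nonneg ‖u x‖, sq_nonneg ‖v x‖]

theorem xiL2_ae (V : ℝ → ℝ) (s : ℝ) (z : ℂ) : ∀ᵐ x, x ∈ Ioo 0 s → xiL2 V s z x = xi V s z x :=
  (ae_restrict_iff' measurableSet_Ioo).mp (memLp_xi V s z).coeFn_toLp

theorem smul_ae (c : ℂ) (f : L2 s) : ∀ᵐ x, x ∈ Ioo 0 s → (c • f) x = c * f x :=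
  (ae_restrict_iff' measurableSet_Ioo).mp (Lp.coeFn_smul c f)

/-- The condition at `0` makes `φ` a multiple of `ξ`; the condition at `s` is the vanishing product.
It gives injectivity of `H - z` when `ξ'(s,z) ≠ 0`, and otherwise that eigenspaces are spanned by
`ξ`. -/
theorem eq_smul_xiL2 (hs : 0 ≤ s) (hV : ContinuousOn V (Icc 0 s)) {φ : L2 s}
    (h : (φ, z • φ) ∈ hGraph V s (Real.pi / 2)) :
    ∃ c : ℂ, φ = c • xiL2 V s z ∧ c * dxi V s z s = 0 := by
  obtain ⟨u, v, h, hu, h0, h1⟩ := exists_rep h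
  have ht : TauEq V s u v (fun x => z * u x) := h.congr (by
    filter_upwards [smul_ae z φ, hu] with x e1 e2 hx
    rw [e1 hx]
    exact congrArg _ (e2 hx))
  have key := eq_const_mul_xi hs hV ht h0
  refine ⟨u 0, ?_, ?_⟩
  · refine Lp.ext ((ae_restrict_iff' measurableSet_Ioo).mpr ?_)
    filter_upwards [hu, smul_ae (u 0) (xiL2 V s z), xiL2_ae V s z] with x e1 e2 e3 hx
    rw [e2 hx, e3 hx, ← (key x (Ioo_subset_Icc_self hx)).1]
    exact e1 hx
  · rw [← (key s (right_mem_Icc.mpr hs)).2, h1]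

theorem xiL2_mem_hGraph (hs : 0 ≤ s) (hV : ContinuousOn V (Icc 0 s)) (hz : dxi V s z s = 0) :
    (xiL2 V s z, z • xiL2 V s z) ∈ hGraph V s (Real.pi / 2) := by
  obtain ⟨h1, h2, h3⟩ := dxi_spec hs hV z
  refine mem_hGraph_of_tauEq h1 ?_ (xiL2_ae V s z) h3 hz
  filter_upwards [smul_ae z (xiL2 V s z), xiL2_ae V s z] with x e1 e2 hx
  rw [e1 hx, e2 hx]

theorem eqOn_Icc_of_ae_eq (hs : 0 < s) {u w : ℝ → ℂ} (hu : ContinuousOn u (Icc 0 s))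
    (hw : ContinuousOn w (Icc 0 s)) (h : ∀ᵐ x, x ∈ Ioo 0 s → u x = w x) :
    EqOn u w (Icc 0 s) := by
  refine Measure.eqOn_Icc_of_ae_eq (μ := volume) hs.ne ?_ hu hw
  rw [restrict_Ioo_eq_restrict_Icc.symm]
  exact (ae_restrict_iff' measurableSet_Ioo).mpr h

theorem xiL2_ne_zero (hs : 0 < s) (hV : ContinuousOn V (Icc 0 s)) (z : ℂ) : xiL2 V s z ≠ 0 := by
  intro h
  obtain ⟨h1, h2, -⟩ := dxi_spec hs.le hV z
  have h3 : EqOn (xi V s z) 0 (Icc 0 s) := by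
    refine eqOn_Icc_of_ae_eq hs h1.continuousOn continuousOn_const ?_
    filter_upwards [xiL2_ae V s z, (ae_restrict_iff' measurableSet_Ioo).mp
      (Lp.coeFn_zero ℂ 2 ((volume : Measure ℝ).restrict (Ioo 0 s)))] with x e1 e2 hx
    rw [← e1 hx, h, e2 hx]
  have := h3 (left_mem_Icc.mpr hs.le)
  rw [h2] at this
  exact one_ne_zero this

/-- If `ξ'(s,z) ≠ 0`, the operator of `exists_resolvent` is a right inverse of `H - z`, and a left
inverse because `H - z` is injective. If `ξ'(s,z) = 0`, then `ξ(·,z)` is a nonzero vector killed by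
`H - z`, which excludes a left inverse. -/
theorem mem_spec_iff (hs : 0 < s) (hV : ContinuousOn V (Icc 0 s)) :
    z ∈ spec (hOp V s (Real.pi / 2)) ↔ dxi V s z s = 0 := by
  have hgraph : ∀ x : (hOp V s (Real.pi / 2)).domain,
      ((x : L2 s), hOp V s (Real.pi / 2) x) ∈ hGraph V s (Real.pi / 2) := fun x => by
    rw [← hOp_graph]
    exact LinearPMap.mem_graph _ x
  have hgraph' : ∀ {x y : L2 s}, (x, y) ∈ hGraph V s (Real.pi / 2) →
      ∃ h : x ∈ (hOp V s (Real.pi / 2)).domain, hOp V s (Real.pi / 2) ⟨x, h⟩ = y := by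
    intro x y hxy
    rw [← hOp_graph, LinearPMap.mem_graph_iff] at hxy
    obtain ⟨x', rfl, h2⟩ := hxy
    exact ⟨x'.2, h2⟩
  constructor
  · intro hz
    by_contra hne
    obtain ⟨R, -, hR⟩ := exists_resolvent hs.le hV hne
    refine hz ⟨R, fun y => ?_, fun x => ?_⟩
    · obtain ⟨h, e⟩ := hgraph' (hR y)
      exact ⟨h, by rw [e, add_sub_cancel_right]⟩
    · set y := hOp V s (Real.pi / 2) x - z • (x : L2 s) with hy
      have hm := Submodule.sub_mem _ (hR y) (hgraph x)
      have he : (R y, y + z • R y) - ((x : L2 s), hOp V s (Real.pi / 2) x) =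
          (R y - x, z • (R y - x)) := by
        rw [hy, Prod.mk_sub_mk, smul_sub]
        congr 1
        abel
      rw [he] at hm
      obtain ⟨c, hc, hc'⟩ := eq_smul_xiL2 hs.le hV hm
      rw [(mul_eq_zero.mp hc').resolve_right hne, zero_smul] at hc
      exact sub_eq_zero.mp hc
  · rintro hz ⟨R, -, hR⟩
    obtain ⟨h, e⟩ := hgraph' (xiL2_mem_hGraph hs.le hV hz)
    have := hR ⟨_, h⟩
    rw [e, sub_self, map_zero] at this
    exact xiL2_ne_zero hs hV z this.symm

theorem conj_eq_self_of_dxi_eq_zero (hs : 0 < s) (hV : ContinuousOn V (Icc 0 s))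
    (hz : dxi V s z s = 0) : conj z = z := by
  have hm := xiL2_mem_hGraph hs.le hV hz
  have := inner_hGraph_symm hs.le hV hm hm
  rw [inner_smul_left, inner_smul_right] at this
  exact mul_right_cancel₀ (inner_self_ne_zero.mpr (xiL2_ne_zero hs hV z)) this

theorem inner_xiL2_eq_zero (hs : 0 < s) (hV : ContinuousOn V (Icc 0 s)) {w : ℂ}
    (hz : dxi V s z s = 0) (hw : dxi V s w s = 0) (hne : z ≠ w) :
    ⟪xiL2 V s z, xiL2 V s w⟫_ℂ = 0 := by
  have := inner_hGraph_symm hs.le hV (xiL2_mem_hGraph hs.le hV hz) (xiL2_mem_hGraph hs.le hV hw)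
  rw [inner_smul_left, inner_smul_right, conj_eq_self_of_dxi_eq_zero hs hV hz] at this
  have h2 : (z - w) * ⟪xiL2 V s z, xiL2 V s w⟫_ℂ = 0 := by linear_combination this
  exact (mul_eq_zero.mp h2).resolve_left (sub_ne_zero.mpr hne)

theorem one_le_re_add_of_dxi_eq_zero (hs : 0 < s) (hV : ContinuousOn V (Icc 0 s)) {c : ℝ}
    (hc : ∀ x ∈ Icc 0 s, 1 ≤ V x + c) (hz : dxi V s z s = 0) : 1 ≤ z.re + c := by
  have := norm_sq_le_form hs hV hc (xiL2_mem_hGraph hs.le hV hz)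
  have hpos : 0 < ‖xiL2 V s z‖ ^ 2 := by
    have := norm_pos_iff.mpr (xiL2_ne_zero hs hV z)
    positivity
  rw [inner_smul_left, conj_eq_self_of_dxi_eq_zero hs hV hz, inner_self_eq_norm_sq_to_K] at this
  have e : (z * ((‖xiL2 V s z‖ : ℝ) : ℂ) ^ 2).re = z.re * ‖xiL2 V s z‖ ^ 2 := by
    rw [← Complex.ofReal_pow, Complex.re_mul_ofReal]
  refine le_of_mul_le_mul_right ?_ hpos
  rw [one_mul, add_mul]
  refine this.trans (le_of_eq ?_)
  exact congrArg (· + _) e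

/-- The eigenfunctions of the Neumann operator are complete in `L₂(0,s)`. -/
theorem eq_zero_of_inner_xiL2 (hs : 0 < s) (hV : ContinuousOn V (Icc 0 s)) {φ : L2 s}
    (hφ : ∀ t, dxi V s t s = 0 → ⟪xiL2 V s t, φ⟫_ℂ = 0) : φ = 0 := by
  obtain ⟨M, hM⟩ := isCompact_Icc.exists_bound_of_continuousOn hV
  set c := M + 1 with hcdef
  have hc : ∀ x ∈ Icc 0 s, 1 ≤ V x + c := fun x hx => by
    have := (abs_le.mp (hM x hx)).1
    linarith
  -- The real point `-c` lies below the spectrum, so the resolvent there exists and is symmetric.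
  have hz : dxi V s ((-c : ℝ) : ℂ) s ≠ 0 := fun h => by
    have := one_le_re_add_of_dxi_eq_zero hs hV hc h
    rw [Complex.ofReal_re] at this
    linarith
  obtain ⟨R, hRc, hR⟩ := exists_resolvent hs.le hV hz
  set z : ℂ := ((-c : ℝ) : ℂ) with hzdef
  have hzc : conj z = z := Complex.conj_ofReal _
  have hsymm : (R : L2 s →ₗ[ℂ] L2 s).IsSymmetric := fun f g => by
    have := inner_hGraph_symm hs.le hV (hR f) (hR g)
    rw [inner_add_left, inner_add_right, inner_smul_left, inner_smul_right, hzc] at this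
    exact (add_right_cancel this).symm
  -- The eigenvectors of `R` span a dense subspace. Those for `μ ≠ 0` are multiples of `ξ(·, μ⁻¹ -
  -- c)`; the eigenvalue `μ = 0` does not occur, since `R x = 0` forces `x = 0`.
  have hbot := ContinuousLinearMap.orthogonalComplement_iSup_eigenspaces_eq_bot hRc hsymm
  have : φ ∈ (⨆ μ, Module.End.eigenspace (R : Module.End ℂ (L2 s)) μ)ᗮ := by
    rw [← Submodule.iInf_orthogonal, Submodule.mem_iInf]
    intro μ x hx
    have hx' : R x = μ • x := Module.End.mem_eigenspace_iff.mp hx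
    have hm := hR x
    by_cases hμ : μ = 0
    · have h0 : R x = 0 := by rw [hx', hμ, zero_smul]
      have := hGraph_snd_eq_zero V s _ _ hm h0
      rw [h0, smul_zero, add_zero] at this
      rw [show x = 0 from this, inner_zero_left]
    · have hm2 := Submodule.smul_mem _ μ⁻¹ hm
      have he : μ⁻¹ • (R x, x + z • R x) = (x, (μ⁻¹ + z) • x) := by
        rw [hx', Prod.smul_mk, smul_smul, inv_mul_cancel₀ hμ, one_smul, smul_add, smul_comm z μ x,
          smul_smul μ⁻¹ μ, inv_mul_cancel₀ hμ, one_smul, add_smul]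
      rw [he] at hm2
      obtain ⟨a, ha, ha'⟩ := eq_smul_xiL2 hs.le hV hm2
      rw [ha, inner_smul_left]
      rcases mul_eq_zero.mp ha' with h | h
      · rw [h, map_zero, zero_mul]
      · rw [hφ _ h, mul_zero]
  rw [hbot] at this
  exact this

end UnderSampling

/-! ### The weighted spectral sum, uniform bounds, and the exact sampling formula. -/

namespace UnderSampling

variable {V : ℝ → ℝ} {s : ℝ} {z : ℂ}

theorem add_ae (f g : L2 s) : ∀ᵐ x, x ∈ Ioo 0 s → (f + g) x = f x + g x :=
  (ae_restrict_iff' measurableSet_Ioo).mp (Lp.coeFn_add f g)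

theorem zero_ae : ∀ᵐ x, x ∈ Ioo 0 s → (0 : L2 s) x = 0 :=
  (ae_restrict_iff' measurableSet_Ioo).mp (Lp.coeFn_zero ℂ 2 _)

/-- A linear combination of Neumann eigenfunctions has a `C¹` representative with value `∑ a t`
at `0`. -/
theorem exists_rep_sum (hs : 0 ≤ s) (hV : ContinuousOn V (Icc 0 s)) (a : ℂ → ℂ) (T : Finset ℂ)
    (hT : ∀ t ∈ T, dxi V s t s = 0) :
    ∃ u v : ℝ → ℂ, TauEq V s u v (∑ t ∈ T, (a t * t) • xiL2 V s t : L2 s) ∧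
      (∀ᵐ x, x ∈ Ioo 0 s → (∑ t ∈ T, a t • xiL2 V s t : L2 s) x = u x) ∧
      v 0 = 0 ∧ v s = 0 ∧ u 0 = ∑ t ∈ T, a t := by
  classical
  induction T using Finset.induction_on with
  | empty =>
    refine ⟨0, 0, ⟨fun x _ => hasDerivWithinAt_const _ _ _, ?_, ?_⟩, ?_, rfl, rfl, rfl⟩
    · simpa [AbsolutelyContinuousOnInterval] using tendsto_const_nhds
    · filter_upwards [zero_ae (s := s)] with x h hx
      exact ⟨0, hasDerivAt_const _ _, by rw [Finset.sum_empty, h hx]; simp⟩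
    · filter_upwards [zero_ae (s := s)] with x h hx
      rw [Finset.sum_empty, h hx]
      rfl
  | insert t T ht ih =>
    obtain ⟨u, v, h, hu, h0, h1, hval⟩ := ih fun t' ht' => hT t' (Finset.mem_insert_of_mem ht')
    obtain ⟨e1, e2, e3⟩ := dxi_spec hs hV t
    refine ⟨_, _, ((e1.const_mul (a t)).add h).congr ?_, ?_, ?_, ?_, ?_⟩
    · rw [Finset.sum_insert ht]
      filter_upwards [add_ae ((a t * t) • xiL2 V s t) (∑ t ∈ T, (a t * t) • xiL2 V s t),
        smul_ae (a t * t) (xiL2 V s t), xiL2_ae V s t] with x i1 i2 i3 hx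
      rw [i1 hx, i2 hx, i3 hx, mul_assoc]
    · rw [Finset.sum_insert ht]
      filter_upwards [add_ae (a t • xiL2 V s t) (∑ t ∈ T, a t • xiL2 V s t),
        smul_ae (a t) (xiL2 V s t), xiL2_ae V s t, hu] with x i1 i2 i3 i4 hx
      rw [i1 hx, i2 hx, i3 hx, i4 hx]
    · rw [e3, h0, mul_zero, add_zero]
    · rw [hT t (Finset.mem_insert_self t T), h1, mul_zero, add_zero]
    · rw [e2, hval, mul_one, Finset.sum_insert ht]

/-- The trace of the resolvent of the Neumann operator at `-c`, weighted by the values of the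
normalized eigenfunctions at `0`, is bounded. -/
theorem sum_inv_le (hs : 0 < s) (hV : ContinuousOn V (Icc 0 s)) {c : ℝ}
    (hc : ∀ x ∈ Icc 0 s, 1 ≤ V x + c) (T : Finset ℂ) (hT : ∀ t ∈ T, dxi V s t s = 0) :
    ∑ t ∈ T, ((t.re + c) * ‖xiL2 V s t‖ ^ 2)⁻¹ ≤ 1 + 1 / s := by
  -- With these coefficients the form of `H + c` at `f` is `∑ a_t² (t + c) ‖ξ(·,t)‖² = ∑ a_t`, which
  -- is also `f(0)` because `ξ(0,t) = 1`.
  set a : ℂ → ℝ := fun t => ((t.re + c) * ‖xiL2 V s t‖ ^ 2)⁻¹ with ha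
  have hk : ∀ t, 0 < ‖xiL2 V s t‖ ^ 2 := fun t => by
    have := norm_pos_iff.mpr (xiL2_ne_zero hs hV t)
    positivity
  have hpos : ∀ t ∈ T, 0 < t.re + c := fun t ht =>
    one_pos.trans_le (one_le_re_add_of_dxi_eq_zero hs hV hc (hT t ht))
  obtain ⟨u, v, h, hu, h0, h1, hval⟩ := exists_rep_sum hs.le hV (fun t => (a t : ℂ)) T hT
  set f : L2 s := ∑ t ∈ T, (a t : ℂ) • xiL2 V s t with hf
  set g : L2 s := ∑ t ∈ T, ((a t : ℂ) * t) • xiL2 V s t with hg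
  have key := trace_le_form (p := (f, g)) hs hV hc h hu h0 h1
  have hinner : ∀ t ∈ T, ⟪xiL2 V s t, f⟫_ℂ = ((a t * ‖xiL2 V s t‖ ^ 2 : ℝ) : ℂ) := by
    intro t ht
    rw [hf, inner_sum, Finset.sum_eq_single_of_mem t ht, inner_smul_right,
      inner_self_eq_norm_sq_to_K]
    · push_cast; rfl
    · intro t' ht' hne
      rw [inner_smul_right, inner_xiL2_eq_zero hs hV (hT t ht) (hT t' ht') hne.symm, mul_zero]
  have hcf : g + (c : ℂ) • f = ∑ t ∈ T, ((a t * (t.re + c) : ℝ) : ℂ) • xiL2 V s t := by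
    rw [hf, hg, Finset.smul_sum, ← Finset.sum_add_distrib]
    refine Finset.sum_congr rfl fun t ht => ?_
    have e := Complex.conj_eq_iff_re.mp (conj_eq_self_of_dxi_eq_zero hs hV (hT t ht))
    rw [smul_smul, ← add_smul]
    congr 1
    push_cast
    rw [e]
    ring
  have hform : (⟪g, f⟫_ℂ).re + c * ‖f‖ ^ 2 = ∑ t ∈ T, a t := by
    have e1 : ⟪g + (c : ℂ) • f, f⟫_ℂ = ((∑ t ∈ T, a t : ℝ) : ℂ) := by
      rw [hcf, sum_inner, Complex.ofReal_sum]
      refine Finset.sum_congr rfl fun t ht => ?_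
      rw [inner_smul_left, hinner t ht, Complex.conj_ofReal, ← Complex.ofReal_mul]
      congr 1
      have := (hpos t ht).ne'
      have := (hk t).ne'
      simp only [ha]
      field_simp
    rw [inner_add_left, inner_smul_left, Complex.conj_ofReal, inner_self_eq_norm_sq_to_K] at e1
    have e2 := congrArg Complex.re e1
    rw [Complex.ofReal_re, Complex.add_re, Complex.re_ofReal_mul] at e2
    rw [← e2]
    congr 2
    exact_mod_cast rfl
  have hS : 0 ≤ ∑ t ∈ T, a t := Finset.sum_nonneg fun t ht =>
    inv_nonneg.mpr (mul_nonneg (hpos t ht).le (hk t).le)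
  rw [hform, hval, ← Complex.ofReal_sum, Complex.norm_real, Real.norm_of_nonneg hS, sq] at key
  -- `key` now reads `S * S ≤ (1 + 1 / s) * S`; divide by `S` unless it is zero.
  rcases hS.eq_or_lt with h2 | h2
  · rw [← h2]; positivity
  · exact le_of_mul_le_mul_right key h2

/-- Gronwall with `|V - z| ≤ M + r`. The bound grows with `r`, so it serves compact sets only; a
half-line of real `t` needs the energy argument of `exists_bound_xi_real`. -/
theorem exists_bound_xi (hs : 0 ≤ s) (hV : ContinuousOn V (Icc 0 s)) (r : ℝ) :
    ∃ B : ℝ, ∀ z : ℂ, ‖z‖ ≤ r → ∀ x ∈ Icc 0 s, ‖xi V s z x‖ ≤ B ∧ ‖dxi V s z x‖ ≤ B := by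
  obtain ⟨M, hM⟩ := isCompact_Icc.exists_bound_of_continuousOn hV
  set L := max 1 (M + r)
  have hL : 1 ≤ L := le_max_left _ _
  refine ⟨Real.exp (L * s), fun z hz x hx => ?_⟩
  obtain ⟨h1, h2, h3⟩ := dxi_spec hs hV z
  have := h1.norm_le hs hV hL (fun y hy => by
    refine (norm_sub_le _ _).trans ((add_le_add ?_ hz).trans (le_max_right _ _))
    rw [Complex.norm_real]
    exact hM y hy) x hx
  have hle : ‖(xi V s z x, dxi V s z x)‖ ≤ Real.exp (L * s) := by
    refine this.trans ?_
    rw [h2, h3, Prod.norm_mk, norm_one, norm_zero, max_eq_left zero_le_one, one_mul]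
    exact Real.exp_le_exp.mpr (mul_le_mul_of_nonneg_left hx.2 (zero_le_one.trans hL))
  rw [Prod.norm_mk] at hle
  exact ⟨(le_max_left _ _).trans hle, (le_max_right _ _).trans hle⟩

/-- The solutions `ξ(·,t)` are uniformly bounded for real `t` bounded below. -/
theorem exists_bound_xi_real (hs : 0 ≤ s) (hV : ContinuousOn V (Icc 0 s)) (c : ℝ) :
    ∃ B : ℝ, ∀ t : ℝ, -c ≤ t → ∀ x ∈ Icc 0 s, ‖xi V s t x‖ ≤ B := by
  obtain ⟨M, hM⟩ := isCompact_Icc.exists_bound_of_continuousOn hV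
  have hM0 : 0 ≤ M := (norm_nonneg _).trans (hM 0 (left_mem_Icc.mpr hs))
  obtain ⟨B, hB⟩ := exists_bound_xi hs hV (max 1 c)
  refine ⟨max B (Real.exp (M * s)), fun t ht x hx => ?_⟩
  rcases le_total t 1 with h | h
  · refine (hB t ?_ x hx).1.trans (le_max_left _ _)
    rw [Complex.norm_real, Real.norm_eq_abs, abs_le]
    exact ⟨by linarith [le_max_right 1 c], h.trans (le_max_left _ _)⟩
  refine le_trans ?_ (le_max_right _ _)
  obtain ⟨h1, h2, h3⟩ := dxi_spec hs hV (t : ℂ)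
  set u := xi V s t
  set v := dxi V s t
  have hd := h1.hasDeriv_deriv hs hV
  have ht0 : 0 < t := by linarith
  -- In `E'` the terms containing `t` cancel, and what is left is at most `M E` because `t ≥ 1`. So
  -- `E` grows at a rate independent of `t` from `E(0) = t`, and division by `t` bounds `|u|²`.
  set E : ℝ → ℝ := fun y => t * ‖u y‖ ^ 2 + ‖v y‖ ^ 2 with hE
  have hderiv : ∀ y ∈ Icc 0 s, HasDerivWithinAt E (2 * V y * ⟪u y, v y⟫_ℝ) (Icc 0 s) y := by
    intro y hy
    refine (((h1.hasDeriv y hy).norm_sq.const_mul t).add (hd y hy).norm_sq).congr_deriv ?_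
    have e1 : ((V y : ℂ) - t) * u y = (V y - t) • u y := by
      rw [Complex.real_smul]; push_cast; ring
    rw [e1, real_inner_smul_right, real_inner_comm (v y) (u y)]
    ring
  have hgr := norm_le_gronwallBound_of_norm_deriv_right_le (f := E)
    (f' := fun y => 2 * V y * ⟪u y, v y⟫_ℝ) (δ := t) (K := M) (ε := 0) (a := 0) (b := s)
    (fun y hy => (hderiv y hy).continuousWithinAt) (fun y hy =>
      (hderiv y (Ico_subset_Icc_self hy)).mono_of_mem_nhdsWithin
        (Filter.mem_of_superset (Icc_mem_nhdsGE hy.2) (Icc_subset_Icc_left hy.1)))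
    (by simp [hE, h2, h3, abs_of_pos ht0]) (fun y hy => by
      have e0 : 0 ≤ E y := by positivity
      rw [Real.norm_eq_abs, Real.norm_of_nonneg e0, abs_mul, abs_mul, abs_two, add_zero]
      have e1 := hM y (Ico_subset_Icc_self hy)
      rw [Real.norm_eq_abs] at e1
      have e2 := abs_real_inner_le_norm (u y) (v y)
      have e3 : 2 * |⟪u y, v y⟫_ℝ| ≤ E y := by
        have : ‖u y‖ ^ 2 ≤ t * ‖u y‖ ^ 2 := le_mul_of_one_le_left (by positivity) h
        simp only [hE]
        nlinarith [sq_nonneg (‖u y‖ - ‖v y‖)]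
      calc 2 * |V y| * |⟪u y, v y⟫_ℝ| = |V y| * (2 * |⟪u y, v y⟫_ℝ|) := by ring
        _ ≤ M * E y := mul_le_mul e1 e3 (by positivity) hM0) x hx
  rw [gronwallBound_ε0, sub_zero] at hgr
  have h4 : t * ‖u x‖ ^ 2 ≤ t * Real.exp (M * x) := by
    refine le_trans ?_ ((le_abs_self _).trans hgr)
    simp only [hE]
    exact le_add_of_nonneg_right (by positivity)
  have h5 : ‖u x‖ ^ 2 ≤ Real.exp (M * s) :=
    (le_of_mul_le_mul_left h4 ht0).trans
      (Real.exp_le_exp.mpr (mul_le_mul_of_nonneg_left hx.2 hM0))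
  have h6 : 1 ≤ Real.exp (M * s) := Real.one_le_exp (mul_nonneg hM0 hs)
  -- No square root is needed: a square bounded by a number at least `1` has its root bounded by
  -- that number.
  nlinarith [norm_nonneg (u x)]

theorem norm_xiL2_le (hs : 0 ≤ s) {B : ℝ} (hB : ∀ x ∈ Icc 0 s, ‖xi V s z x‖ ≤ B) :
    ‖xiL2 V s z‖ ≤ √s * B := by
  have hB0 : 0 ≤ B := (norm_nonneg _).trans (hB 0 (left_mem_Icc.mpr hs))
  refine (Lp.norm_le_of_ae_bound hB0 ((ae_restrict_iff' measurableSet_Ioo).mpr ?_)).trans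
    (le_of_eq ?_)
  · filter_upwards [xiL2_ae V s z] with x h hx
    rw [h hx]
    exact hB x (Ioo_subset_Icc_self hx)
  · rw [Real.sqrt_eq_rpow]
    congr 1
    have e : ((measureUnivNNReal ((volume : Measure ℝ).restrict (Ioo 0 s)) : NNReal) : ℝ) = s := by
      change ((volume : Measure ℝ).restrict (Ioo 0 s)).real univ = s
      rw [measureReal_restrict_apply_univ, Real.volume_real_Ioo_of_le hs, sub_zero]
    rw [e]
    norm_num

/-- Green's identity for the conjugate of `ξ(·,z̄)` and `ξ(·,t)`. The boundary terms at `0` vanish,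
and at `s` one is removed by `ξ'(s,t) = 0`. The surviving term stays bounded along the spectrum. -/
theorem kernel_mul_sub (hs : 0 < s) (hV : ContinuousOn V (Icc 0 s)) {t : ℂ}
    (ht : dxi V s t s = 0) :
    (t - z) * kernel V s z t = conj (dxi V s (conj z) s) * xi V s t s := by
  obtain ⟨h1, h2, h3⟩ := dxi_spec hs.le hV (conj z)
  obtain ⟨k1, k2, k3⟩ := dxi_spec hs.le hV t
  have hi : ∀ {f : ℝ → ℂ}, ContinuousOn f (Icc 0 s) → IntervalIntegrable f volume 0 s :=
    intervalIntegrable_of_continuousOn hs.le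
  have key := h1.conj.green hs.le hV k1
    (hi (Complex.continuous_conj.comp_continuousOn (continuousOn_const.mul h1.continuousOn)))
    (hi (continuousOn_const.mul k1.continuousOn))
  rw [kernel_eq_inner, conj_eq_self_of_dxi_eq_zero hs hV ht,
    inner_L2_eq hs.le (xiL2_ae _ _ _) (xiL2_ae _ _ _), sub_mul,
    ← intervalIntegral.integral_const_mul, ← intervalIntegral.integral_const_mul]
  simp only [h3, k3, ht, map_mul, map_zero, Complex.conj_conj, zero_mul, mul_zero, sub_zero,
    add_zero] at key
  have e1 : (fun x => t * ((starRingEnd ℂ) (xi V s ((starRingEnd ℂ) z) x) * xi V s t x)) =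
      fun x => (starRingEnd ℂ) (xi V s ((starRingEnd ℂ) z) x) * (t * xi V s t x) := by
    ext x; ring
  simp only [mul_assoc] at key
  rw [e1, ← key]
  ring

/-- Uniform decay of the kernel along the Neumann spectrum. -/
theorem exists_kernel_bound (hs : 0 < s) (hV : ContinuousOn V (Icc 0 s)) {c : ℝ}
    (hc : ∀ x ∈ Icc 0 s, 1 ≤ V x + c) (r : ℝ) :
    ∃ A : ℝ, ∀ z t : ℂ, ‖z‖ ≤ r → dxi V s t s = 0 → (t.re + c) * ‖kernel V s z t‖ ≤ A := by
  obtain ⟨B, hB⟩ := exists_bound_xi hs.le hV r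
  obtain ⟨C, hC⟩ := exists_bound_xi_real hs.le hV c
  refine ⟨B * C + (r + |c|) * (√s * B * (√s * C)), fun z t hz ht => ?_⟩
  have hzc : ‖conj z‖ ≤ r := by rwa [Complex.norm_conj]
  have htr := one_le_re_add_of_dxi_eq_zero hs hV hc ht
  have hconj := conj_eq_self_of_dxi_eq_zero hs hV ht
  have hre := Complex.conj_eq_iff_re.mp hconj
  have hCt : ∀ x ∈ Icc 0 s, ‖xi V s t x‖ ≤ C := by
    have := hC t.re (by linarith)
    rwa [hre] at this
  have hBz : ∀ x ∈ Icc 0 s, ‖xi V s (conj z) x‖ ≤ B := fun x hx => (hB _ hzc x hx).1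
  have hm : s ∈ Icc 0 s := right_mem_Icc.mpr hs.le
  have hB0 : 0 ≤ B := (norm_nonneg _).trans (hBz s hm)
  -- Writing `t + c = (t - z) + (z + c)` avoids dividing by `t - z`, which may vanish.
  have e1 : (((t.re + c : ℝ) : ℂ)) * kernel V s z t =
      (t - z) * kernel V s z t + (z + c) * kernel V s z t := by
    push_cast
    rw [hre]
    ring
  have e2 : (t.re + c) * ‖kernel V s z t‖ = ‖((t.re + c : ℝ) : ℂ) * kernel V s z t‖ := by
    rw [norm_mul, Complex.norm_real, Real.norm_of_nonneg (by linarith)]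
  have e3 : ‖kernel V s z t‖ ≤ √s * B * (√s * C) := by
    rw [kernel_eq_inner, hconj]
    exact (norm_inner_le_norm _ _).trans (mul_le_mul (norm_xiL2_le hs.le hBz)
      (norm_xiL2_le hs.le hCt) (norm_nonneg _) (by positivity))
  rw [e2, e1, kernel_mul_sub hs hV ht]
  refine (norm_add_le _ _).trans (add_le_add ?_ ?_)
  · rw [norm_mul, Complex.norm_conj]
    exact mul_le_mul (hB _ hzc s hm).2 (hCt s hm) (norm_nonneg _) hB0
  · rw [norm_mul]
    refine mul_le_mul ((norm_add_le _ _).trans (add_le_add hz ?_)) e3 (norm_nonneg _)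
      (add_nonneg ((norm_nonneg _).trans hz) (abs_nonneg _))
    rw [Complex.norm_real, Real.norm_eq_abs]

theorem kernel_self (hs : 0 < s) (hV : ContinuousOn V (Icc 0 s)) {t : ℂ}
    (ht : dxi V s t s = 0) : kernel V s t t = ((‖xiL2 V s t‖ ^ 2 : ℝ) : ℂ) := by
  rw [kernel_eq_inner, conj_eq_self_of_dxi_eq_zero hs hV ht, inner_self_eq_norm_sq_to_K]
  exact_mod_cast rfl

/-- The sampling series over the Neumann spectrum reproduces the functions in `B_s`. -/
theorem hasSum_sampleTerm (hs : 0 < s) (hV : ContinuousOn V (Icc 0 s)) (φ : L2 s) (z : ℂ) :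
    HasSum (fun t : spec (hOp V s (Real.pi / 2)) => sampleTerm V s (transform V s φ) z t)
      (transform V s φ z) := by
  have ht : ∀ t : spec (hOp V s (Real.pi / 2)), dxi V s t s = 0 := fun t =>
    (mem_spec_iff hs hV).mp t.2
  have hne : ∀ t : ℂ, (‖xiL2 V s t‖ : ℂ) ≠ 0 := fun t =>
    Complex.ofReal_ne_zero.mpr (norm_ne_zero_iff.mpr (xiL2_ne_zero hs hV t))
  set e : spec (hOp V s (Real.pi / 2)) → L2 s := fun t => ((‖xiL2 V s t‖ : ℂ)⁻¹) • xiL2 V s t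
    with he
  have hon : Orthonormal ℂ e := by
    refine ⟨fun t => ?_, fun t t' htt' => ?_⟩
    · rw [he, norm_smul, norm_inv, Complex.norm_real, norm_norm]
      exact inv_mul_cancel₀ (norm_ne_zero_iff.mpr (xiL2_ne_zero hs hV t))
    · simp only [he]
      rw [inner_smul_left, inner_smul_right, inner_xiL2_eq_zero hs hV (ht t) (ht t')
        (fun h => htt' (Subtype.ext h)), mul_zero, mul_zero]
  have hbot : (Submodule.span ℂ (range e))ᗮ = ⊥ := by
    rw [Submodule.eq_bot_iff]
    intro φ hφ
    refine eq_zero_of_inner_xiL2 hs hV fun t htz => ?_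
    have := hφ _ (Submodule.subset_span ⟨⟨t, (mem_spec_iff hs hV).mpr htz⟩, rfl⟩)
    simp only [he, inner_smul_left] at this
    exact (mul_eq_zero.mp this).resolve_left ((map_ne_zero _).mpr (inv_ne_zero (hne t)))
  set bs := HilbertBasis.mkOfOrthogonalEqBot hon hbot with hbs
  have hbe : ∀ t, bs t = e t := fun t => by rw [hbs, HilbertBasis.coe_mkOfOrthogonalEqBot]
  -- Parseval's identity for `⟨ξ(·,z̄), φ⟩`. As `t` is real, its factors are, up to normalization,
  -- `k(z,t)` and the sample at `t`.
  have key := bs.hasSum_inner_mul_inner (xiL2 V s (conj z)) φ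
  refine key.congr_fun fun t => ?_
  rw [hbe, sampleTerm, transform_apply, kernel_self hs hV (ht t), kernel_eq_inner,
    conj_eq_self_of_dxi_eq_zero hs hV (ht t)]
  simp only [he]
  rw [inner_smul_right, inner_smul_left, map_inv₀, Complex.conj_ofReal]
  have := hne t
  push_cast
  field_simp

end UnderSampling

/-! ### The tail on `(s,b)` and the aliasing error. -/

namespace UnderSampling

variable {V : ℝ → ℝ} {s b : ℝ} {z : ℂ}

/-- The restriction of an element of `L₂(0,b)` to `(0,s)`. -/
noncomputable def restrictL2 (hsb : s ≤ b) (ψ : L2 b) : L2 s :=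
  ((Lp.memLp ψ).mono_measure
    (Measure.restrict_mono (Ioo_subset_Ioo_right hsb) le_rfl)).toLp ψ

theorem restrictL2_ae (hsb : s ≤ b) (ψ : L2 b) :
    ∀ᵐ x, x ∈ Ioo 0 s → restrictL2 hsb ψ x = ψ x :=
  (ae_restrict_iff' measurableSet_Ioo).mp (MemLp.coeFn_toLp _)

/-- The transform of the part of `ψ` that lives on `(s,b)`. -/
noncomputable def tailTransform (V : ℝ → ℝ) (s b : ℝ) (ψ : L2 b) (z : ℂ) : ℂ :=
  ∫ x in s..b, conj (xi V b (conj z) x) * ψ x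

theorem transform_eq_add_tail (hs : 0 ≤ s) (hsb : s ≤ b) (hV : ContinuousOn V (Icc 0 b))
    (ψ : L2 b) (z : ℂ) :
    transform V b ψ z = transform V s (restrictL2 hsb ψ) z + tailTransform V s b ψ z := by
  have hb := hs.trans hsb
  have hc : ContinuousOn (fun x => conj (xi V b (conj z) x)) (Icc 0 b) :=
    Complex.continuous_conj.comp_continuousOn (dxi_spec hb hV (conj z)).1.continuousOn
  have hi : IntervalIntegrable (fun x => conj (xi V b (conj z) x) * ψ x) volume 0 b :=
    (intervalIntegrable_L2 hb ψ).continuousOn_mul (by rwa [uIcc_of_le hb])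
  have hm : s ∈ uIcc 0 b := by rw [uIcc_of_le hb]; exact ⟨hs, hsb⟩
  have hxi : ∀ᵐ x, x ∈ Ioo 0 s → xiL2 V s (conj z) x = xi V b (conj z) x := by
    filter_upwards [xiL2_ae V s (conj z)] with x h hx
    rw [h hx, xi_restrict hs hsb hV _ (Ioo_subset_Icc_self hx)]
  rw [transform_apply, transform_apply, inner_L2_eq hb (xiL2_ae _ _ _) (eventually_self _),
    inner_L2_eq hs hxi (restrictL2_ae hsb ψ), tailTransform,
    intervalIntegral.integral_add_adjacent_intervals
      (hi.mono_set (uIcc_subset_uIcc left_mem_uIcc hm))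
      (hi.mono_set (uIcc_subset_uIcc hm right_mem_uIcc))]

theorem norm_tailTransform_le (hs : 0 ≤ s) (hsb : s ≤ b) (ψ : L2 b) {B : ℝ}
    (hB : ∀ x ∈ Icc 0 b, ‖xi V b (conj z) x‖ ≤ B) :
    ‖tailTransform V s b ψ z‖ ≤ B * ∫ x in s..b, ‖ψ x‖ := by
  have hb := hs.trans hsb
  rw [← intervalIntegral.integral_const_mul]
  refine intervalIntegral.norm_integral_le_of_norm_le hsb
    (Filter.Eventually.of_forall fun x hx => ?_)
    ((intervalIntegrable_L2' hb ψ ⟨hs, hsb⟩ (right_mem_Icc.mpr hb)).norm.const_mul B)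
  rw [norm_mul, Complex.norm_conj]
  exact mul_le_mul_of_nonneg_right (hB x ⟨hs.trans hx.1.le, hx.2⟩) (norm_nonneg _)

/-- The sampling series over the Neumann spectrum on `(0,s)` of a function in `B_b`, `b ≥ s`:
absolute convergence and the aliasing error. -/
theorem exists_sampling_bound (hs : 0 < s) (hsb : s ≤ b) (hV : ContinuousOn V (Icc 0 b)) (r : ℝ) :
    ∃ D : ℝ, 0 < D ∧ ∀ (ψ : L2 b) (z : ℂ), ‖z‖ ≤ r →
      (Summable fun t : spec (hOp V s (Real.pi / 2)) =>
        sampleTerm V s (transform V b ψ) z t) ∧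
      ‖transform V b ψ z - sampleSeries V s (Real.pi / 2) (transform V b ψ) z‖ ≤
        D * ∫ x in s..b, ‖ψ x‖ := by
  have hb : 0 ≤ b := hs.le.trans hsb
  have hVs : ContinuousOn V (Icc 0 s) := hV.mono (Icc_subset_Icc_right hsb)
  obtain ⟨M, hM⟩ := isCompact_Icc.exists_bound_of_continuousOn hV
  set c := M + 1 with hcdef
  have hc : ∀ x ∈ Icc 0 s, 1 ≤ V x + c := fun x hx => by
    have := (abs_le.mp (hM x ⟨hx.1, hx.2.trans hsb⟩)).1
    linarith
  obtain ⟨A, hA⟩ := exists_kernel_bound hs hVs hc r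
  obtain ⟨B, hB⟩ := exists_bound_xi hb hV r
  obtain ⟨C, hC⟩ := exists_bound_xi_real hb hV c
  -- `|B|` bounds the tail transform at `z`, the product bounds its sampling series, and the `1`
  -- only makes the constant positive.
  refine ⟨|B| + |C| * |A| * (1 + 1 / s) + 1, by positivity, fun ψ z hz => ?_⟩
  set W := ∫ x in s..b, ‖ψ x‖ with hW
  have hW0 : 0 ≤ W := intervalIntegral.integral_nonneg hsb fun x _ => norm_nonneg _
  set q : spec (hOp V s (Real.pi / 2)) → ℝ :=
    fun t => (((t : ℂ).re + c) * ‖xiL2 V s t‖ ^ 2)⁻¹ with hq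
  have ht : ∀ t : spec (hOp V s (Real.pi / 2)), dxi V s t s = 0 := fun t =>
    (mem_spec_iff hs hVs).mp t.2
  have htr : ∀ t : spec (hOp V s (Real.pi / 2)), 1 ≤ (t : ℂ).re + c := fun t =>
    one_le_re_add_of_dxi_eq_zero hs hVs hc (ht t)
  have hk : ∀ t, 0 < ‖xiL2 V s t‖ ^ 2 := fun t => by
    have := norm_pos_iff.mpr (xiL2_ne_zero hs hVs t)
    positivity
  have hq0 : ∀ t, 0 ≤ q t := fun t =>
    inv_nonneg.mpr (mul_nonneg (zero_le_one.trans (htr t)) (hk _).le)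
  have hqs : ∀ T : Finset (spec (hOp V s (Real.pi / 2))), ∑ t ∈ T, q t ≤ 1 + 1 / s := fun T => by
    have := sum_inv_le hs hVs hc (T.map (Function.Embedding.subtype _)) fun t h => by
      obtain ⟨t', -, rfl⟩ := Finset.mem_map.mp h
      exact ht t'
    rwa [Finset.sum_map] at this
  have hqsum : Summable q := summable_of_sum_le hq0 hqs
  have hterm : ∀ t : spec (hOp V s (Real.pi / 2)),
      ‖sampleTerm V s (tailTransform V s b ψ) z t‖ ≤ |C| * |A| * W * q t := fun t => by
    have hconj := conj_eq_self_of_dxi_eq_zero hs hVs (ht t)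
    have hre := Complex.conj_eq_iff_re.mp hconj
    have e1 : ‖tailTransform V s b ψ t‖ ≤ |C| * W := by
      refine norm_tailTransform_le hs.le hsb ψ fun x hx => ?_
      have := hC (t : ℂ).re (by linarith [htr t]) x hx
      rw [hre] at this
      rw [hconj]
      exact this.trans (le_abs_self C)
    have e2 : ‖kernel V s z t‖ ≤ |A| / ((t : ℂ).re + c) := by
      rw [le_div_iff₀ (one_pos.trans_le (htr t)), mul_comm]
      exact (hA z t hz (ht t)).trans (le_abs_self A)
    rw [sampleTerm, norm_mul, norm_div, kernel_self hs hVs (ht t), Complex.norm_real,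
      Real.norm_of_nonneg (hk _).le]
    calc _ ≤ |C| * W * (|A| / ((t : ℂ).re + c) / ‖xiL2 V s t‖ ^ 2) := by gcongr
      _ = _ := by rw [hq, div_div, div_eq_mul_inv]; ring
  have htail : Summable fun t : spec (hOp V s (Real.pi / 2)) =>
      sampleTerm V s (tailTransform V s b ψ) z t :=
    Summable.of_norm_bounded (hqsum.mul_left _) hterm
  have hmain := hasSum_sampleTerm hs hVs (restrictL2 hsb ψ) z
  have hsplit : (fun t : spec (hOp V s (Real.pi / 2)) => sampleTerm V s (transform V b ψ) z t) =
      fun t : spec (hOp V s (Real.pi / 2)) =>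
        sampleTerm V s (transform V s (restrictL2 hsb ψ)) z t +
          sampleTerm V s (tailTransform V s b ψ) z t := by
    ext t
    rw [sampleTerm, transform_eq_add_tail hs.le hsb hV, add_mul]
    rfl
  have hsum := hmain.add htail.hasSum
  rw [← hsplit] at hsum
  refine ⟨hsum.summable, ?_⟩
  -- The exactly reproduced part on `(0,s)` cancels; the tail minus its own sampling series remains.
  rw [sampleSeries, hsum.tsum_eq, transform_eq_add_tail hs.le hsb hV, add_sub_add_left_eq_sub]
  have e1 : ‖tailTransform V s b ψ z‖ ≤ |B| * W :=
    norm_tailTransform_le hs.le hsb ψ fun x hx =>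
      (hB (conj z) (by rwa [Complex.norm_conj]) x hx).1.trans (le_abs_self B)
  have e2 : ‖∑' t : spec (hOp V s (Real.pi / 2)), sampleTerm V s (tailTransform V s b ψ) z t‖ ≤
      |C| * |A| * W * (1 + 1 / s) := by
    refine (tsum_of_norm_bounded (hqsum.mul_left (|C| * |A| * W)).hasSum hterm).trans ?_
    rw [tsum_mul_left]
    exact mul_le_mul_of_nonneg_left (Real.tsum_le_of_sum_le hq0 hqs) (by positivity)
  refine (norm_sub_le _ _).trans ((add_le_add e1 e2).trans ?_)
  linarith

end UnderSampling

theorem theorem4p1 (b : ℝ) (hb : Real.pi < b) (V : ℝ → ℝ)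
    (hV : AbsolutelyContinuousOnInterval V 0 b) :
    (∀ (g : UnderSampling.DeBranges V b) (z : ℂ),
      Summable fun t : UnderSampling.spec (UnderSampling.hOp V Real.pi (Real.pi / 2)) =>
        UnderSampling.sampleTerm V Real.pi g z t) ∧
    ∀ K : Set ℂ, IsCompact K → ∃ D : ℝ, 0 < D ∧
      ∀ (g : UnderSampling.DeBranges V b) (ψ : UnderSampling.L2 b),
        (∀ z : ℂ, g z = ⟪UnderSampling.xiL2 V b (conj z), ψ⟫_ℂ) →
        ∀ z ∈ K,
          ‖g z - UnderSampling.sampleSeries V Real.pi (Real.pi / 2) g z‖ ≤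
            D * ∫ x in Real.pi..b, ‖ψ x‖ := by
  have hVc : ContinuousOn V (Icc 0 b) := by
    simpa [uIcc_of_le (Real.pi_pos.trans hb).le] using hV.continuousOn
  refine ⟨fun g z => ?_, fun K hK => ?_⟩
  -- Summability over an index set in `ℂ` is absolute, so the first half of the bound suffices, with
  -- `r = ‖z‖`.
  · obtain ⟨D, -, h⟩ := UnderSampling.exists_sampling_bound Real.pi_pos hb.le hVc ‖z‖
    exact (h g z le_rfl).1
  · obtain ⟨r, hr⟩ := hK.isBounded.exists_norm_le
    obtain ⟨D, hD, h⟩ := UnderSampling.exists_sampling_bound Real.pi_pos hb.le hVc r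
    refine ⟨D, hD, fun g ψ hg z hz => ?_⟩
    -- The estimate depends on `g` only as a function, so `ψ` need not be the vector that records
    -- `g`.
    have e : (g : ℂ → ℂ) = UnderSampling.transform V b ψ := funext hg
    rw [e]
    exact (h ψ z (hr z hz)).2
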